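/- Let $w$ be an infinite word and let $0=n_1<n_2<\cdots$ be the lengths of its palindromic prefixes. Put $\delta(w)=\limsup_{i} n_{i+1}/n_i$ if there are infinitely many of them, and $\delta(w)=\infty$ otherwise. Let $\mathcal D\subset[0,\infty]$ be the set of all values $\delta(w)$, let $\mathcal D_0$ be the set of values $\delta(w)$ for words $w$ having infinitely many palindromic prefixes and such that $n_{i+1}\le 2n_i+1$ for all $i\ge 1$, and let $\mathcal D'$ be the set of values $\delta(w)$ for words $w$ that are either periodic of the form $w=uuu\cdots$ with $u$ a non-empty palindrome, or characteristic Sturmian. Here $w$ is characteristic Sturmian if there are letters $a\ne b$ and positive integers $s_1,s_2,\dots$ such that $w$ is the limit of the words $\sigma_n$ given by $\sigma_0=a$, $\sigma_1=a^{s_1-1}b$, $\sigma_n=\sigma_{n-1}^{s_n}\sigma_{n-2}$ for $n\ge 2$; that is, every $\sigma_n$ with $n\ge1$ is a prefix of $w$. Then $\sqrt3=[1,1,2,1,2,1,\dots]=[1,1,\overline{2,1}]$ and $\frac{7+\sqrt{13}}6=[1,1,3,3,3,\dots]=[1,1,\overline{3}]$ as regular continued fractions, and there is no element $x$ of $\mathcal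 D'$ with $$\sqrt3<x<\frac{7+\sqrt{13}}6 .$$ Moreover $\sqrt3$ is optimal in the equalities $\mathcal D'\cap[1,\sqrt3]=\mathcal D_0\cap[1,\sqrt3]=\mathcal D\cap[1,\sqrt3]$: for every real $c>\sqrt3$ we have $\mathcal D'\cap[1,c]\ne\mathcal D_0\cap[1,c]$ and $\mathcal D'\cap[1,c]\ne\mathcal D\cap[1,c]$. -/

import Mathlib

open Filter
open scoped ENNReal

noncomputable section

namespace PalPrefix

/-- The prefix of length `n` of the (right) infinite word `w`, whose letters are
`w 0, w 1, w 2, …`. -/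
def pre {A : Type} (w : ℕ → A) (n : ℕ) : List A := (List.range n).map w

/-- `n` is the length of a palindromic prefix of `w` (the empty word is a palindrome). -/
def IsPalLength {A : Type} (w : ℕ → A) (n : ℕ) : Prop := (pre w n).Palindrome

/-- `w` has infinitely many palindromic prefixes. -/
def InfPal {A : Type} (w : ℕ → A) : Prop := {n | IsPalLength w n}.Infinite

/-- The increasing sequence of all lengths of palindromic prefixes of `w`, numbered from `0`,
so that `palLength w 0 = 0`. It is meaningful when there are infinitely many of them. -/
def palLength {A : Type} (w : ℕ → A) (i : ℕ) : ℕ := Nat.nth (IsPalLength w) i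

open Classical in
/-- `δ(w) = limsup n_{i+1} / n_i`, where `(n_i)` is the sequence of lengths of palindromic
prefixes of `w`, if this sequence is infinite, and `δ(w) = ∞` otherwise. -/
def delta {A : Type} (w : ℕ → A) : ℝ≥0∞ :=
  if InfPal w then
    limsup (fun i : ℕ => (palLength w (i + 1) : ℝ≥0∞) / (palLength w i : ℝ≥0∞)) atTop
  else ∞

/-- Words with abundant palindromic prefixes: `n_{i+1} ≤ 2 n_i + 1` for every `i`. -/
def Abundant {A : Type} (w : ℕ → A) : Prop :=
  InfPal w ∧ ∀ i, palLength w (i + 1) ≤ 2 * palLength w i + 1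

/-- `w = u u u …` for some non-empty palindrome `u` (here `u` is the prefix of length `p`). -/
def IsPeriodicPal {A : Type} (w : ℕ → A) : Prop :=
  ∃ p, 0 < p ∧ IsPalLength w p ∧ ∀ i, w (i + p) = w i

/-- The standard sequence attached to `s 1, s 2, …` and the letters `a`, `b`:
`σ_0 = a`, `σ_1 = a^{s_1 - 1} b` and `σ_n = σ_{n-1}^{s_n} σ_{n-2}` for `n ≥ 2`.
The value `s 0` is not used. -/
def stdSeq {A : Type} (s : ℕ → ℕ) (a b : A) : ℕ → List A
  | 0 => [a]
  | 1 => List.replicate (s 1 - 1) a ++ [b]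
  | n + 2 => (List.replicate (s (n + 2)) (stdSeq s a b (n + 1))).flatten ++ stdSeq s a b n

/-- `w` is the characteristic Sturmian word with slope `[0, s_1, s_2, …]` over the two letters
`a ≠ b`, for some positive integers `s_1, s_2, …`: it is the limit of the words `σ_n`, that is
the infinite word of which all `σ_n` with `n ≥ 1` are prefixes. -/
def IsCharSturmian {A : Type} (w : ℕ → A) : Prop :=
  ∃ a b : A, a ≠ b ∧ ∃ s : ℕ → ℕ, (∀ k, 1 ≤ k → 1 ≤ s k) ∧
    ∀ n, 1 ≤ n → pre w (stdSeq s a b n).length = stdSeq s a b n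

/-- The set `𝒟` of all values `δ(w)`. An infinite word uses countably many letters only, so
alphabets in `Type` are enough. -/
def specD : Set ℝ≥0∞ := {x | ∃ (A : Type) (w : ℕ → A), delta w = x}

/-- The set `𝒟₀` of all values `δ(w)` for words with abundant palindromic prefixes. -/
def specD0 : Set ℝ≥0∞ := {x | ∃ (A : Type) (w : ℕ → A), Abundant w ∧ delta w = x}

/-- The set `𝒟'` of all values `δ(w)` for periodic words with a palindromic period and for
characteristic Sturmian words. -/
def specD' : Set ℝ≥0∞ :=
  {x | ∃ (A : Type) (w : ℕ → A), (IsPeriodicPal w ∨ IsCharSturmian w) ∧ delta w = x}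

/-- `x = [a_0, a_1, a_2, …]`: the regular continued fraction expansion of `x` is infinite, with
partial quotients `a_0, a_1, a_2, …`. -/
def HasContFrac (x : ℝ) (a : ℕ → ℕ) : Prop :=
  (GenContFract.of x).h = a 0 ∧
    ∀ n, (GenContFract.of x).s.get? n = some ⟨1, (a (n + 1) : ℝ)⟩

end PalPrefix

end

namespace PalPrefix

variable {A : Type} {w : ℕ → A}

/-! The gap in `𝒟'`. Write q_n for the length of σ_n. From length s_1 - 1 on, the palindromic
prefixes of a characteristic Sturmian word have exactly the lengths (k+1)q_{n+1} + q_n - 2 with 0 ≤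
k ≤ s_{n+2} (`isPalLength_central`, `not_isPalLength_of_mem_gap`). Only the gaps starting at k = 0
matter: with r_n = q_n/q_{n+1} their ratio is asymptotically (2+r_n)/(1+r_n), and 1/r_{n+1} =
s_{n+2} + r_n. If s_n ≥ 3 infinitely often, then r_n ≤ [0,3,3,…] infinitely often and δ ≥ (7+√13)/6;
otherwise liminf r_n ≥ [0,2,1,2,1,…] and δ ≤ √3. A palindromic period makes δ at most every c > 1.

Optimality. By the gap it suffices to find abundant words with δ above √3 but arbitrarily close to
it. For a palindromic prefix of length N let N-p and N-q be the longest shorter ones followed by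
either letter. The two palindromic closures `a`, `b` act linearly on (N,p,q) and preserve the defect
p+q-N. A further move `c` skips a closure and goes to N+2p-q. If N ≈ p+q, its gap has ratio about
3p/(p+q), which is √3 exactly when p/q = (√3+1)/2, the attracting ratio of the block `aab`. So one
repeats rounds (ab)^k (aab)^k c b: the first block makes the relative defect small, the second
brings p/q close to (√3+1)/2 from above, and `c` yields a gap slightly above √3. All gap ratios stay
below √3 + 2·2^{-k} (`Follows.rounds`). -/

/-! ### Palindromic prefixes: periods and reflections -/

lemma isPalLength_iff {n : ℕ} :
    IsPalLength w n ↔ ∀ i j, i + j + 1 = n → w i = w j := by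
  unfold IsPalLength pre
  rw [List.Palindrome.iff_reverse_eq]
  constructor
  · intro h i j hij
    have h1 : ((List.range n).map w).reverse[i]? = ((List.range n).map w)[i]? := by rw [h]
    rw [List.getElem?_reverse (by simp; omega)] at h1
    have hj : n - 1 - i = j := by omega
    simp only [List.length_map, List.length_range, hj, List.getElem?_map,
      List.getElem?_range (show j < n by omega), List.getElem?_range (show i < n by omega),
      Option.map_some, Option.some.injEq] at h1
    exact h1.symm
  · intro h
    apply List.ext_getElem (by simp)
    intro i h1 h2
    simp only [List.length_map, List.length_range] at h2
    simp only [List.getElem_reverse, List.getElem_map, List.getElem_range, List.length_map,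
      List.length_range]
    exact h _ _ (by omega)

lemma isPalLength_zero : IsPalLength w 0 := isPalLength_iff.2 fun i j h => by omega

/-- Two nested palindromic prefixes give a period of the longer one. -/
lemma IsPalLength.period {m t : ℕ} (h : IsPalLength w (m + t)) (hm : IsPalLength w m) :
    ∀ i < m, w (i + t) = w i := by
  rw [isPalLength_iff] at h hm
  intro i hi
  rw [hm i (m - 1 - i) (by omega)]
  exact h _ _ (by omega)

/-- A palindromic prefix that is continued with period `t` for `t` more letters yields a
palindromic prefix. -/
lemma IsPalLength.extend {N t : ℕ} (h : IsPalLength w N) (ht : t ≤ N + 1)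
    (hp : ∀ i < N, w (i + t) = w i) : IsPalLength w (N + t) := by
  rw [isPalLength_iff] at h ⊢
  intro i j hij
  rcases Nat.lt_or_ge i t with hi | hi
  · rcases Nat.lt_or_ge j t with hj | hj
    · rw [show i = j by omega]
    · obtain ⟨j, rfl⟩ := Nat.exists_eq_add_of_le' hj
      rw [hp j (by omega)]
      exact h _ _ (by omega)
  · obtain ⟨i, rfl⟩ := Nat.exists_eq_add_of_le' hi
    rw [hp i (by omega)]
    exact h _ _ (by omega)

/-- Reflecting a palindromic prefix in a shorter one. -/
lemma IsPalLength.reflect {m d : ℕ} (hd : 0 < d) (h1 : IsPalLength w (m + d))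
    (h2 : IsPalLength w (m + d + d)) : IsPalLength w m ∧ w m = w (m + d) := by
  rw [isPalLength_iff] at h1 h2
  refine ⟨isPalLength_iff.2 fun i j hij => ?_, ?_⟩
  · rw [h1 i (j + d) (by omega), h2 (j + d) (i + d) (by omega)]
    exact h1 _ _ (by omega)
  · rw [h1 m (d - 1) (by omega)]
    exact h2 _ _ (by omega)

/-- The tool for excluding palindromic prefixes: one slightly longer than `N` produces one shorter
than `N` that is followed by the same letter as the prefix of length `N`. -/
lemma IsPalLength.reflect_sub {N n : ℕ} (hN : IsPalLength w N) (hn : IsPalLength w n)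
    (h : N < n) (h' : n ≤ 2 * N) : IsPalLength w (2 * N - n) ∧ w (2 * N - n) = w N := by
  have := IsPalLength.reflect (w := w) (m := 2 * N - n) (d := n - N) (by omega)
    (by convert hN using 1; omega) (by convert hn using 1; omega)
  rwa [show 2 * N - n + (n - N) = N by omega] at this

/-! ### Bounding `δ` from chains and gaps of palindromic prefixes -/

lemma exists_palLength_eq {n : ℕ} (hn : IsPalLength w n) :
    ∃ i, palLength w i = n := by
  classical
  exact Nat.exists_lt_card_nth_eq hn |>.imp fun i h => h.2

lemma palLength_strictMono (hw : InfPal w) : StrictMono (palLength w) := Nat.nth_strictMono hw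

lemma isPalLength_palLength (hw : InfPal w) (i : ℕ) : IsPalLength w (palLength w i) :=
  Nat.nth_mem_of_infinite hw i

lemma palLength_succ_le (hw : InfPal w) {i n : ℕ} (hn : IsPalLength w n)
    (h : palLength w i < n) : palLength w (i + 1) ≤ n := by
  obtain ⟨j, rfl⟩ := exists_palLength_eq hn
  exact (palLength_strictMono hw).monotone ((palLength_strictMono hw).lt_iff_lt.1 h)

lemma infPal_of_forall_exists (h : ∀ n, ∃ m, n < m ∧ IsPalLength w m) : InfPal w :=
  Set.infinite_of_forall_exists_gt fun n => (h n).imp fun _ h => ⟨h.2, h.1⟩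

lemma infPal_of_tendsto {L : ℕ → ℕ} (hpal : ∀ j, IsPalLength w (L j))
    (htop : Tendsto L atTop atTop) : InfPal w :=
  infPal_of_forall_exists fun n =>
    ((htop.eventually (eventually_gt_atTop n)).exists).elim fun j hj => ⟨L j, hj, hpal j⟩

/-- An upper bound for `δ(w)` from a sequence of palindromic prefixes whose lengths grow
slowly. -/
lemma delta_le_of_chain {c : ℝ} {L : ℕ → ℕ} (hpal : ∀ j, IsPalLength w (L j))
    (htop : Tendsto L atTop atTop) (h : ∀ᶠ j in atTop, (L (j + 1) : ℝ) ≤ c * L j) :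
    delta w ≤ ENNReal.ofReal c := by
  have hw := infPal_of_tendsto hpal htop
  rw [delta, if_pos hw]
  obtain ⟨j₀, hj₀⟩ := eventually_atTop.1 h
  have hP := (palLength_strictMono hw).tendsto_atTop
  apply limsup_le_of_le
  · isBoundedDefault
  filter_upwards [hP.eventually (eventually_ge_atTop (L j₀ + 1))] with i hi
  -- `L` need be neither monotone nor exhaustive: at the first index after `j₀` where `L` exceeds
  -- `n_i`, the preceding value is at most `n_i`.
  obtain ⟨j, hj, hlt, hle⟩ : ∃ j, j₀ ≤ j ∧ palLength w i < L (j + 1) ∧ L j ≤ palLength w i := by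
    classical
    have hex : ∃ j, palLength w i < L (j₀ + j) := by
      obtain ⟨j, hj, hj'⟩ := ((htop.eventually (eventually_gt_atTop (palLength w i))).and
        (eventually_ge_atTop j₀)).exists
      exact ⟨j - j₀, by rwa [Nat.add_sub_cancel' hj']⟩
    have h1 := Nat.find_spec hex
    have h2 : Nat.find hex ≠ 0 := by
      intro h0
      rw [h0] at h1
      simp at h1
      omega
    obtain ⟨m, hm⟩ := Nat.exists_eq_succ_of_ne_zero h2
    refine ⟨j₀ + m, by omega, ?_, ?_⟩
    · rw [hm] at h1
      exact h1
    · exact not_lt.1 (Nat.find_min hex (m := m) (by omega))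
  have h1 := palLength_succ_le hw (hpal (j + 1)) hlt
  have hpos : (0 : ℝ) < palLength w i := by exact_mod_cast (by omega : 0 < palLength w i)
  have h2 : (palLength w (i + 1) : ℝ) ≤ c * L j :=
    le_trans (by exact_mod_cast h1) (hj₀ j hj)
  have hc : 0 ≤ c := by
    by_contra hc
    have h3 : c * L j ≤ 0 := mul_nonpos_of_nonpos_of_nonneg (by linarith) (by positivity)
    have h4 := palLength_strictMono hw (lt_add_one i)
    have h5 : (0 : ℝ) < palLength w (i + 1) := by
      exact_mod_cast (by omega : 0 < palLength w (i + 1))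
    linarith
  have h3 : (palLength w (i + 1) : ℝ) ≤ c * palLength w i :=
    h2.trans (mul_le_mul_of_nonneg_left (by exact_mod_cast hle) hc)
  apply ENNReal.div_le_of_le_mul
  rw [← ENNReal.ofReal_natCast, ← ENNReal.ofReal_natCast, ← ENNReal.ofReal_mul hc]
  exact ENNReal.ofReal_le_ofReal h3

/-- A lower bound for `δ(w)` from infinitely many long gaps between palindromic prefixes. -/
lemma le_delta_of_gaps {c : ℝ} (h : ∀ M : ℕ, ∃ N ≥ M, IsPalLength w N ∧
    ∀ n, IsPalLength w n → N < n → c * N ≤ n) : ENNReal.ofReal c ≤ delta w := by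
  rw [delta]
  split_ifs with hw
  swap
  · exact le_top
  apply le_limsup_of_frequently_le
  swap
  · isBoundedDefault
  rw [frequently_atTop]
  intro M
  obtain ⟨N, hN, hpal, hgap⟩ := h (palLength w M + 1)
  obtain ⟨i, rfl⟩ := exists_palLength_eq hpal
  refine ⟨i, ((palLength_strictMono hw).lt_iff_lt.1 hN).le, ?_⟩
  have h1 := hgap _ (isPalLength_palLength hw (i + 1)) (palLength_strictMono hw (lt_add_one i))
  have hpos : 0 < palLength w i := by omega
  rw [ENNReal.le_div_iff_mul_le (by simp; omega) (by simp)]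
  rw [← ENNReal.ofReal_natCast, ← ENNReal.ofReal_natCast, ← ENNReal.ofReal_mul' (by positivity)]
  exact ENNReal.ofReal_le_ofReal h1

lemma abundant_of_forall_exists
    (h : ∀ N, IsPalLength w N → ∃ n, IsPalLength w n ∧ N < n ∧ n ≤ 2 * N + 1) : Abundant w := by
  have hw : InfPal w := by
    apply infPal_of_forall_exists
    intro n
    induction n with
    | zero =>
      obtain ⟨m, hm, h0, -⟩ := h 0 isPalLength_zero
      exact ⟨m, h0, hm⟩
    | succ n ih =>
      obtain ⟨m, hm, h0⟩ := ih
      obtain ⟨k, hk, h1, -⟩ := h m h0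
      exact ⟨k, by omega, hk⟩
  refine ⟨hw, fun i => ?_⟩
  obtain ⟨n, hn, h1, h2⟩ := h _ (isPalLength_palLength hw i)
  exact (palLength_succ_le hw hn h1).trans h2

lemma delta_le_of_forall_gt {c : ℝ} (h : ∀ c' > c, delta w ≤ ENNReal.ofReal c') :
    delta w ≤ ENNReal.ofReal c := by
  by_contra! hlt
  obtain ⟨r, hr, h1, h2⟩ := ENNReal.lt_iff_exists_real_btwn.1 hlt
  have hcr : c < r := by
    by_contra! hcr
    exact absurd (ENNReal.ofReal_le_ofReal hcr) (not_le.2 h1)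
  exact absurd (h r hcr) (not_le.2 h2)

lemma IsPeriodicPal.delta_le (h : IsPeriodicPal w) {c : ℝ} (hc : 1 < c) :
    delta w ≤ ENNReal.ofReal c := by
  obtain ⟨p, hp, hpal, hper⟩ := h
  apply delta_le_of_chain (L := fun j => p * j)
  · intro j
    induction j with
    | zero => exact isPalLength_zero
    | succ j ih =>
      rcases Nat.eq_zero_or_pos j with rfl | hj
      · simpa using hpal
      · rw [Nat.mul_succ]
        exact ih.extend (le_trans (Nat.le_mul_of_pos_right p hj) (Nat.le_succ _))
          fun i _ => hper i
  · exact tendsto_id.const_mul_atTop' hp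
  · filter_upwards [tendsto_natCast_atTop_atTop.eventually (eventually_ge_atTop (1 / (c - 1)))]
      with j hj
    have h1 : 1 ≤ (c - 1) * j := by
      rwa [div_le_iff₀ (by linarith), mul_comm] at hj
    have hp' : (0 : ℝ) < p := by exact_mod_cast hp
    push_cast
    nlinarith

/-! ### Palindromic prefixes of characteristic Sturmian words -/

/-- The properties of a characteristic Sturmian word `w` and of the lengths `q n` of the words
`σ_n` that determine the palindromic prefixes of `w`. -/
structure SturmianData (w : ℕ → A) (a b : A) (s q : ℕ → ℕ) : Prop where
  ne : a ≠ b
  pos : ∀ k, 1 ≤ k → 1 ≤ s k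
  q_zero : q 0 = 1
  q_one : q 1 = s 1
  q_rec : ∀ n, q (n + 2) = s (n + 2) * q (n + 1) + q n
  left : ∀ i, i + 1 < q 1 → w i = a
  right : w (q 1 - 1) = b
  two : w (s 2 * q 1) = a
  power : ∀ n i, i + q (n + 1) < s (n + 2) * q (n + 1) → w (i + q (n + 1)) = w i
  tail : ∀ n i, i < q (n + 1) → w (s (n + 3) * q (n + 2) + i) = w i

lemma getElem?_of_pre_eq {l : List A} (h : pre w l.length = l) {i : ℕ} (hi : i < l.length) :
    l[i]? = some (w i) := by
  rw [← h]
  simp [pre, hi]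

lemma getElem?_flatten_replicate {l m : List A} {k i : ℕ} (h : i + l.length < k * l.length) :
    ((List.replicate k l).flatten ++ m)[i + l.length]? =
      ((List.replicate k l).flatten ++ m)[i]? := by
  cases k with
  | zero => simp at h
  | succ k =>
    have h1 : i < ((List.replicate k l).flatten).length := by
      simp only [List.length_flatten, List.map_replicate, List.sum_replicate, smul_eq_mul]
      rw [Nat.succ_mul] at h
      omega
    conv_lhs => rw [List.replicate_succ, List.flatten_cons, List.append_assoc,
      List.getElem?_append_right (by omega), Nat.add_sub_cancel, List.getElem?_append_left h1]
    rw [List.replicate_succ', List.flatten_append, List.append_assoc,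
      List.getElem?_append_left h1]

lemma IsCharSturmian.exists_data (h : IsCharSturmian w) :
    ∃ a b s q, SturmianData w a b s q := by
  obtain ⟨a, b, hab, s, hs, hpre⟩ := h
  have hq0 : (stdSeq s a b 0).length = 1 := rfl
  have hq1 : (stdSeq s a b 1).length = s 1 := by
    have := hs 1 le_rfl
    simp only [stdSeq, List.length_append, List.length_replicate, List.length_singleton]
    omega
  have hqr : ∀ n, (stdSeq s a b (n + 2)).length =
      s (n + 2) * (stdSeq s a b (n + 1)).length + (stdSeq s a b n).length := by
    intro n
    simp [stdSeq]
  have key : ∀ n i, i < (stdSeq s a b (n + 1)).length → (stdSeq s a b (n + 1))[i]? = some (w i) :=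
    fun n i hi => getElem?_of_pre_eq (hpre _ (by omega)) hi
  have htail : ∀ n i, i < (stdSeq s a b n).length →
      (stdSeq s a b n)[i]? = some (w (s (n + 2) * (stdSeq s a b (n + 1)).length + i)) := by
    intro n i hi
    rw [← key (n + 1) _ (by rw [hqr]; omega)]
    rw [show stdSeq s a b (n + 1 + 1) =
      (List.replicate (s (n + 2)) (stdSeq s a b (n + 1))).flatten ++ stdSeq s a b n from rfl]
    rw [List.getElem?_append_right (by simp)]
    simp
  refine ⟨a, b, s, fun n => (stdSeq s a b n).length, hab, hs, hq0, hq1, hqr, ?_, ?_, ?_, ?_, ?_⟩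
  · intro i hi
    have h1 := key 0 i (by simp only [zero_add]; omega)
    have h2 : i < s 1 - 1 := by omega
    simp only [stdSeq] at h1
    rw [List.getElem?_append_left (by simpa using h2)] at h1
    simpa [List.getElem?_replicate, h2] using h1.symm
  · have h0 := hs 1 le_rfl
    have h1 := key 0 (s 1 - 1) (by simp only [zero_add]; omega)
    simp only [stdSeq] at h1
    rw [List.getElem?_append_right (by simp)] at h1
    simp only [List.length_replicate, Nat.sub_self, List.getElem?_cons_zero,
      Option.some.injEq] at h1
    simp only [hq1]
    exact h1.symm
  · have h1 := htail 0 0 (by simp [hq0])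
    simpa [stdSeq] using h1.symm
  · intro n i hi
    have h1 := key (n + 1) (i + (stdSeq s a b (n + 1)).length) (by rw [hqr]; omega)
    have h2 := key (n + 1) i (by rw [hqr]; omega)
    rw [show stdSeq s a b (n + 1 + 1) =
      (List.replicate (s (n + 2)) (stdSeq s a b (n + 1))).flatten ++ stdSeq s a b n from rfl]
      at h1 h2
    rw [getElem?_flatten_replicate hi, h2] at h1
    exact (Option.some.inj h1).symm
  · intro n i hi
    have h1 := htail (n + 1) i hi
    rw [key n i hi] at h1
    exact (Option.some.inj h1).symm

namespace SturmianData

variable {a b : A} {s q : ℕ → ℕ}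

lemma q_pos (h : SturmianData w a b s q) (n : ℕ) : 0 < q n := by
  induction n using Nat.twoStepInduction with
  | zero => rw [h.q_zero]; exact one_pos
  | one => rw [h.q_one]; exact h.pos 1 le_rfl
  | more n ih _ => rw [h.q_rec]; omega

lemma q_add_le (h : SturmianData w a b s q) (n : ℕ) : q (n + 1) + q n ≤ q (n + 2) := by
  rw [h.q_rec]
  exact Nat.add_le_add_right (Nat.le_mul_of_pos_left _ (h.pos _ (by omega))) _

lemma q_le_succ (h : SturmianData w a b s q) (n : ℕ) : q n ≤ q (n + 1) := by
  cases n with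
  | zero => rw [h.q_zero]; exact h.q_pos 1
  | succ n => exact le_trans (Nat.le_add_right _ _) (h.q_add_le n)

lemma le_q_succ (h : SturmianData w a b s q) (n : ℕ) : n + 1 ≤ q (n + 1) := by
  induction n with
  | zero => exact h.q_pos 1
  | succ n ih =>
    have h1 := h.q_add_le n
    have h2 := h.q_pos n
    exact le_trans (by omega) h1

lemma power_mul (h : SturmianData w a b s q) (n i k : ℕ)
    (hi : i + k * q (n + 1) < s (n + 2) * q (n + 1)) : w (i + k * q (n + 1)) = w i := by
  induction k with
  | zero => simp
  | succ k ih =>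
    rw [Nat.succ_mul] at hi ⊢
    rw [← add_assoc, h.power n _ (by omega)]
    exact ih (by omega)

/-- After σ_{n+2} the word restarts with σ_{n+1}: if s_{n+3} = 1 this is the tail of σ_{n+3}, and
otherwise σ_{n+2}² is a prefix. -/
lemma shift (h : SturmianData w a b s q) (n i : ℕ) (hi : i < q (n + 1)) :
    w (q (n + 2) + i) = w i := by
  have h1 : q (n + 1) ≤ q (n + 2) := h.q_le_succ (n + 1)
  rcases (h.pos (n + 3) (by omega)).eq_or_lt with hs | hs
  · have := h.tail n i hi
    rwa [← hs, one_mul] at this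
  · rw [add_comm]
    apply h.power (n + 1)
    change i + q (n + 2) < s (n + 3) * q (n + 2)
    have : 2 * q (n + 2) ≤ s (n + 3) * q (n + 2) := Nat.mul_le_mul_right _ hs
    omega

/-- Treated apart from the general induction because the tail σ_0 = a of σ_2 need not be a prefix of
`w` (it is not when s_1 = 1); the letters are compared with `a` directly. -/
lemma period_one (h : SturmianData w a b s q) (i : ℕ) (hi : i + 2 < q 2) :
    w (i + q 1) = w i := by
  have hr := h.q_rec 0
  rw [h.q_zero] at hr
  simp only [zero_add] at hr
  rcases Nat.lt_or_ge (i + q 1) (s 2 * q 1) with hlt | hge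
  · exact h.power 0 i hlt
  obtain ⟨k, hk⟩ := Nat.exists_eq_add_of_le' (h.pos 2 (by omega))
  have hs : s 2 * q 1 = k * q 1 + q 1 := by rw [hk, Nat.succ_mul]
  obtain ⟨j, rfl⟩ := Nat.exists_eq_add_of_le' (show k * q 1 ≤ i by omega)
  have h1 : w (j + k * q 1) = a := by
    rw [h.power_mul 0 j k (by simp only [zero_add]; omega)]
    exact h.left j (by omega)
  rw [h1]
  rcases Nat.eq_zero_or_pos j with rfl | hj
  · rw [show 0 + k * q 1 + q 1 = s 2 * q 1 by omega]
    exact h.two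
  · rw [show j + k * q 1 + q 1 = q 2 + (j - 1) by omega, h.shift 0 _ (by simp only [zero_add]; omega)]
    exact h.left _ (by omega)

/-- The prefix of `w` of length `q (n + 1) + q n - 2` has period `q n`. -/
lemma period (h : SturmianData w a b s q) (n i : ℕ) (hi : i + 2 < q (n + 1)) :
    w (i + q n) = w i := by
  induction n generalizing i with
  | zero =>
    rw [h.q_zero, h.left i (by simp only [zero_add] at hi; omega)]
    exact h.left _ (by simp only [zero_add] at hi; omega)
  | succ n ih =>
    cases n with
    | zero => exact h.period_one i hi
    | succ m =>
      have hr : q (m + 3) = s (m + 3) * q (m + 2) + q (m + 1) := h.q_rec (m + 1)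
      change i + 2 < q (m + 3) at hi
      change ∀ i, i + 2 < q (m + 2) → w (i + q (m + 1)) = w i at ih
      change w (i + q (m + 2)) = w i
      have hsh : ∀ i < q (m + 2), w (q (m + 3) + i) = w i := h.shift (m + 1)
      have hle : q (m + 1) ≤ q (m + 2) := h.q_le_succ (m + 1)
      rcases Nat.lt_or_ge (i + q (m + 2)) (s (m + 3) * q (m + 2)) with hlt | hge
      · exact h.power (m + 1) i hlt
      -- Beyond the power σ_{m+2}^{k+1}, with k + 1 = s_{m+3}, write i = j + k q_{m+2}; both letters
      -- turn out to equal `w j`.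
      obtain ⟨k, hk⟩ := Nat.exists_eq_add_of_le' (h.pos (m + 3) (by omega))
      have hs : s (m + 3) * q (m + 2) = k * q (m + 2) + q (m + 2) := by rw [hk, Nat.succ_mul]
      obtain ⟨j, rfl⟩ := Nat.exists_eq_add_of_le' (show k * q (m + 2) ≤ i by omega)
      have e1 : w (j + k * q (m + 2) + q (m + 2)) = w j := by
        rcases Nat.lt_or_ge j (q (m + 1)) with hj | hj
        · rw [← h.tail m j hj]
          congr 1
          omega
        · obtain ⟨l, rfl⟩ := Nat.exists_eq_add_of_le' hj
          rw [show l + q (m + 1) + k * q (m + 2) + q (m + 2) = q (m + 3) + l by omega,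
            hsh l (by omega), ih l (by omega)]
      have e2 : w (j + k * q (m + 2)) = w j := by
        rcases Nat.lt_or_ge j (q (m + 2)) with hj | hj
        · exact h.power_mul (m + 1) j k (by
            change j + k * q (m + 2) < s (m + 3) * q (m + 2)
            omega)
        · obtain ⟨l, rfl⟩ := Nat.exists_eq_add_of_le' hj
          rw [show l + q (m + 2) + k * q (m + 2) = s (m + 3) * q (m + 2) + l by omega,
            h.tail m l (by omega), add_comm, h.shift m l (by omega)]
      exact e1.trans e2.symm

/-- The lengths of the central prefixes; these are exactly the lengths of the palindromic
prefixes of `w`. -/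
def centralLength (q : ℕ → ℕ) (n k : ℕ) : ℕ := (k + 1) * q (n + 1) + q n - 2

lemma centralLength_zero (h : SturmianData w a b s q) (n : ℕ) :
    centralLength q n 0 + 2 = q (n + 1) + q n := by
  have h1 := h.q_pos n
  have h2 := h.q_pos (n + 1)
  simp only [centralLength]
  omega

lemma centralLength_succ (h : SturmianData w a b s q) (n k : ℕ) :
    centralLength q n (k + 1) = centralLength q n k + q (n + 1) := by
  have h1 := h.q_pos n
  have h2 : 0 < (k + 1) * q (n + 1) := Nat.mul_pos (by omega) (h.q_pos _)
  simp only [centralLength, Nat.succ_mul (k + 1)]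
  omega

/-- Consecutive blocks share an endpoint, so the central lengths form one chain through all `n`. -/
lemma centralLength_top (h : SturmianData w a b s q) (n : ℕ) :
    centralLength q n (s (n + 2)) = centralLength q (n + 1) 0 := by
  simp only [centralLength, h.q_rec n, Nat.succ_mul]
  congr 1
  omega

lemma centralLength_add_two (h : SturmianData w a b s q) (n k : ℕ) :
    centralLength q n k + 2 = (k + 1) * q (n + 1) + q n := by
  have h1 := h.q_pos n
  have h2 : 0 < (k + 1) * q (n + 1) := Nat.mul_pos (by omega) (h.q_pos _)
  simp only [centralLength]
  omega

lemma centralLength_pred (h : SturmianData w a b s q) (n : ℕ) :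
    centralLength q n (s (n + 2) - 1) + 2 = q (n + 2) := by
  rw [h.centralLength_add_two, Nat.sub_add_cancel (h.pos _ (by omega)), h.q_rec]

/-- Within block `n` each central prefix extends the previous one by one period q_{n+1}; the chain
starts with a^{s_1-1}. -/
lemma isPalLength_central (h : SturmianData w a b s q) (n k : ℕ) (hk : k ≤ s (n + 2)) :
    IsPalLength w (centralLength q n k) := by
  have step : ∀ n, IsPalLength w (centralLength q n 0) →
      ∀ k ≤ s (n + 2), IsPalLength w (centralLength q n k) := by
    intro n h0 k hk
    induction k with
    | zero => exact h0
    | succ k ih =>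
      have h2 := h.centralLength_add_two n k
      have h3 := h.q_pos n
      have h4 : (k + 1) * q (n + 1) ≤ s (n + 2) * q (n + 1) := Nat.mul_le_mul_right _ hk
      rw [h.centralLength_succ]
      apply (ih (by omega)).extend
      · rw [Nat.succ_mul] at h2
        omega
      · intro i hi
        apply h.period
        rw [h.q_rec]
        omega
  have h0 : ∀ n, IsPalLength w (centralLength q n 0) := by
    intro n
    induction n with
    | zero =>
      rw [isPalLength_iff]
      intro i j hij
      have := h.centralLength_zero 0
      rw [h.q_zero] at this
      simp only [zero_add] at this
      rw [h.left i (by omega), h.left j (by omega)]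
    | succ n ih =>
      rw [← h.centralLength_top]
      exact step n ih _ le_rfl
  exact step n (h0 n) k hk

lemma letter_central_eq (h : SturmianData w a b s q) (n k : ℕ) (hk : k < s (n + 2)) :
    w (centralLength q n k) = w (centralLength q n 0) := by
  induction k with
  | zero => rfl
  | succ k ih =>
    rw [h.centralLength_succ, h.period, ih (by omega)]
    have h2 := h.centralLength_add_two n k
    have h4 : (k + 2) * q (n + 1) ≤ s (n + 2) * q (n + 1) := Nat.mul_le_mul_right _ hk
    have h3 := h.q_pos (n + 1)
    rw [h.q_rec]
    rw [Nat.succ_mul (k + 1)] at h4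
    omega

lemma letter_central_zero (h : SturmianData w a b s q) (n : ℕ) :
    w (centralLength q n 0) = if Even n then b else a := by
  induction n using Nat.twoStepInduction with
  | zero =>
    have := h.centralLength_zero 0
    rw [h.q_zero] at this
    simp only [zero_add] at this
    rw [show centralLength q 0 0 = q 1 - 1 by omega, h.right]
    simp
  | one =>
    have h1 := h.centralLength_zero 1
    have h2 := h.q_rec 0
    rw [h.q_zero] at h2
    simp only [zero_add, Nat.reduceAdd] at h1 h2
    rw [if_neg (by decide)]
    rcases Nat.eq_or_lt_of_le (h.q_pos 1) with h3 | h3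
    · rw [show centralLength q 1 0 = s 2 * q 1 by omega]
      exact h.two
    · rw [show centralLength q 1 0 = q 2 + (q 1 - 2) by omega,
        h.shift 0 _ (by simp only [zero_add]; omega)]
      exact h.left _ (by omega)
  | more n ih _ =>
    have h1 : centralLength q (n + 2) 0 + 2 = q (n + 3) + q (n + 2) := h.centralLength_zero (n + 2)
    have h2 := h.centralLength_pred n
    have hsh : ∀ i < q (n + 2), w (q (n + 3) + i) = w i := h.shift (n + 1)
    rw [show centralLength q (n + 2) 0 = q (n + 3) + centralLength q n (s (n + 2) - 1) by omega,
      hsh _ (by omega),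
      h.letter_central_eq n _ (Nat.sub_lt (h.pos _ (by omega)) one_pos), ih]
    simp [Nat.even_add]

/-- The letter following a central prefix is constant on a block, its top excluded, and alternates
from block to block. This is what rules out further palindromic prefixes at the start of a block. -/
lemma letter_central_ne (h : SturmianData w a b s q) (n : ℕ) :
    w (centralLength q n 0) ≠ w (centralLength q (n + 1) 0) := by
  rw [h.letter_central_zero, h.letter_central_zero]
  have := h.ne
  by_cases hn : Even n <;> simp [Nat.even_add_one, hn, this, this.symm]

lemma exists_central_gap (q : ℕ → ℕ) (n K m : ℕ)
    (h0 : centralLength q n 0 ≤ m) (h1 : m < centralLength q n K) :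
    ∃ k < K, centralLength q n k ≤ m ∧ m < centralLength q n (k + 1) := by
  induction K with
  | zero => omega
  | succ K ih =>
    rcases Nat.lt_or_ge m (centralLength q n K) with h2 | h2
    · obtain ⟨k, hk, h3⟩ := ih h2
      exact ⟨k, by omega, h3⟩
    · exact ⟨K, by omega, h2, h1⟩

/-- There are no further palindromic prefixes between consecutive central ones. -/
lemma not_isPalLength_of_mem_gap (h : SturmianData w a b s q) (n k : ℕ) (hk : k < s (n + 2))
    {m : ℕ} (h1 : centralLength q n k < m) (h2 : m < centralLength q n (k + 1)) :
    ¬ IsPalLength w m := by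
  induction n using Nat.strong_induction_on generalizing m k with
  | _ n ihn =>
  induction k generalizing m with
  | succ k ihk =>
    intro hm
    have e1 := h.centralLength_succ n k
    have e2 := h.centralLength_succ n (k + 1)
    have e3 := h.centralLength_add_two n k
    have e4 := h.q_pos n
    rw [Nat.succ_mul] at e3
    -- Reflection in the central prefix at which the gap begins moves `m` into the preceding gap of
    -- the same block.
    refine ihk (by omega) (m := 2 * centralLength q n (k + 1) - m) (by omega) (by omega) ?_
    exact ((h.isPalLength_central n (k + 1) hk.le).reflect_sub hm h1 (by omega)).1
  | zero =>
    intro hm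
    have e1 := h.centralLength_succ n 0
    have e3 := h.centralLength_zero n
    have e4 := h.q_pos n
    -- At the start of a block the reflected length exceeds q_n - 2. For `n = p + 1` it therefore
    -- lies in the last gap of block `p - 1`, inside a gap of block `p`, or at a central length of
    -- block `p`; the last case contradicts the alternation of letters.
    obtain ⟨r1, r2⟩ := (h.isPalLength_central n 0 (by omega)).reflect_sub hm h1 (by omega)
    cases n with
    | zero =>
      rw [h.q_zero] at e3
      simp only [zero_add] at *
      rw [show centralLength q 0 0 = q 1 - 1 by omega, h.right, h.left _ (by omega)] at r2
      exact h.ne r2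
    | succ p =>
      set m' := 2 * centralLength q (p + 1) 0 - m with hm'
      have e5 := h.centralLength_zero p
      have hge : centralLength q p 0 ≤ m' := by
        by_contra! hlt
        cases p with
        | zero =>
          rw [h.q_zero] at e5
          simp only [zero_add] at *
          omega
        | succ p =>
          have e6 := h.centralLength_pred p
          have e7 := h.centralLength_top p
          have e8 := h.pos (p + 2) (by omega)
          refine ihn p (by omega) (s (p + 2) - 1) (by omega) ?_ ?_ r1
          · change centralLength q (p + 2) 0 + 2 = q (p + 3) + q (p + 2) at e3
            change centralLength q (p + 2) 1 = centralLength q (p + 2) 0 + q (p + 3) at e1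
            change m < centralLength q (p + 2) 1 at h2
            change m' = 2 * centralLength q (p + 2) 0 - m at hm'
            omega
          rw [Nat.sub_add_cancel e8, e7]
          exact hlt
      have hlt : m' < centralLength q p (s (p + 2)) := by
        rw [h.centralLength_top]
        omega
      obtain ⟨k, hk', h3, h4⟩ := exists_central_gap q p _ m' hge hlt
      rcases h3.eq_or_lt with h3 | h3
      · rw [← h3, h.letter_central_eq p k hk'] at r2
        exact h.letter_central_ne p r2
      · exact ihn p (by omega) k hk' h3 h4 r1

/-! ### `δ` of Sturmian words and the gap in `𝒟'` -/

lemma le_delta_of_frequently (h : SturmianData w a b s q) {K x : ℝ}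
    (hKx : ∀ r ≤ x, K * (1 + r) ≤ 2 + r)
    (hx : ∀ M, ∃ n ≥ M, (q n : ℝ) ≤ x * q (n + 1)) : ENNReal.ofReal K ≤ delta w := by
  -- Subtracting 2 from both lengths preserves a ratio bound `K` only for `1 ≤ K`; for `K < 1` the
  -- bound is trivial.
  have hK1 : 1 ≤ K ∨ K < 1 := le_or_gt 1 K
  apply le_delta_of_gaps
  intro M
  obtain ⟨n, hn, hq⟩ := hx M
  have h0 := h.centralLength_zero n
  have h1 := h.centralLength_succ n 0
  have hpos := h.q_pos n
  refine ⟨centralLength q n 0, ?_, h.isPalLength_central n 0 (by omega), ?_⟩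
  · have := h.le_q_succ n
    omega
  intro m hm hlt
  have h2 : centralLength q n 1 ≤ m := by
    by_contra! h3
    exact h.not_isPalLength_of_mem_gap n 0 (h.pos _ (by omega)) hlt h3 hm
  have hq1 : (0 : ℝ) < q (n + 1) := by exact_mod_cast h.q_pos (n + 1)
  have h3 := hKx (q n / q (n + 1)) (by rwa [div_le_iff₀ hq1])
  have h4 : K * (q (n + 1) + q n : ℝ) ≤ 2 * q (n + 1) + q n := by
    have := mul_le_mul_of_nonneg_right h3 hq1.le
    field_simp at this
    linarith
  have h0' : (centralLength q n 0 : ℝ) + 2 = q (n + 1) + q n := by exact_mod_cast h0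
  have h1' : (centralLength q n 1 : ℝ) = centralLength q n 0 + q (n + 1) := by exact_mod_cast h1
  have h2' : (centralLength q n 1 : ℝ) ≤ m := by exact_mod_cast h2
  rcases hK1 with hK1 | hK1
  · nlinarith
  · have : (0 : ℝ) ≤ centralLength q n 0 := by positivity
    nlinarith

/-- If partial quotients `≥ 3` occur infinitely often, then `δ(w) ≥ [1, 1, 3, 3, 3, …]`. -/
lemma le_delta_of_three_le (h : SturmianData w a b s q) (h3 : ∀ M, ∃ n ≥ M, 3 ≤ s n) :
    ENNReal.ofReal ((7 + √13) / 6) ≤ delta w := by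
  have h13 : √13 * √13 = 13 := Real.mul_self_sqrt (by norm_num)
  have hlo : (3.6 : ℝ) ≤ √13 := Real.le_sqrt_of_sq_le (by norm_num)
  -- Here x = [0,3,3,…] solves x(3+x) = 1, and the constant is (2+x)/(1+x).
  apply h.le_delta_of_frequently (x := (√13 - 3) / 2)
  · intro r hr
    nlinarith
  -- If r_n > x from some index on, a quotient s_{n+2} ≥ 3 gives r_{n+1} < 1/(3+x) = x, a
  -- contradiction.
  by_contra! hcon
  obtain ⟨M, hM⟩ := hcon
  obtain ⟨n, hn, hs⟩ := h3 (M + 2)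
  obtain ⟨n, rfl⟩ := Nat.exists_eq_add_of_le' (show 2 ≤ n by omega)
  have h1 := hM n (by omega)
  have h2 := hM (n + 1) (by omega)
  have hr : (q (n + 2) : ℝ) = s (n + 2) * q (n + 1) + q n := by exact_mod_cast h.q_rec n
  have hs' : (3 : ℝ) ≤ s (n + 2) := by exact_mod_cast hs
  have hq1 : (0 : ℝ) < q (n + 1) := by exact_mod_cast h.q_pos (n + 1)
  have h4 : (3 : ℝ) * q (n + 1) ≤ s (n + 2) * q (n + 1) := mul_le_mul_of_nonneg_right hs' hq1.le
  change (√13 - 3) / 2 * q (n + 2) < (q (n + 1) : ℝ) at h2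
  rw [hr] at h2
  nlinarith

/-- A bounded defect of `q n / q (n + 1)` from `[0, 2, 1, 2, 1, …]`, if the partial quotients are
eventually at most `2`. -/
lemma exists_defect_bound (h : SturmianData w a b s q) {M : ℕ} (hM : ∀ n ≥ M, s n ≤ 2) :
    ∃ C : ℝ, ∀ n ≥ M, (√3 - 1) / 2 * q (n + 1) - q n ≤ C := by
  have h3 : √3 * √3 = 3 := Real.mul_self_sqrt (by norm_num)
  have hlo : (1.73 : ℝ) ≤ √3 := Real.le_sqrt_of_sq_le (by norm_num)
  have hhi : √3 ≤ (1.74 : ℝ) := Real.sqrt_le_iff.2 (by norm_num)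
  set C : ℝ := max 0 (max ((√3 - 1) / 2 * q (M + 1) - q M) ((√3 - 1) / 2 * q (M + 2) - q (M + 1)))
    with hC
  have hC0 : 0 ≤ C := le_max_left _ _
  refine ⟨C, fun n hn => ?_⟩
  obtain ⟨j, rfl⟩ := Nat.exists_eq_add_of_le hn
  clear hn
  induction j using Nat.twoStepInduction with
  | zero => exact le_trans (le_max_left _ _) (le_max_right _ _)
  | one => exact le_trans (le_max_right _ _) (le_max_right _ _)
  | more j ih _ =>
    have e1 : q (M + j + 3) = s (M + j + 3) * q (M + j + 2) + q (M + j + 1) := h.q_rec (M + j + 1)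
    have e2 : q (M + j + 1) + q (M + j) ≤ q (M + j + 2) := h.q_add_le (M + j)
    have e3 := h.pos (M + j + 3) (by omega)
    have e4 := hM (M + j + 3) (by omega)
    have e2' : (q (M + j + 1) : ℝ) + q (M + j) ≤ q (M + j + 2) := by exact_mod_cast e2
    have p0 : (0 : ℝ) ≤ q (M + j) := by positivity
    have p1 : (0 : ℝ) ≤ q (M + j + 1) := by positivity
    change (√3 - 1) / 2 * (q (M + j + 3) : ℝ) - q (M + j + 2) ≤ C
    -- For a quotient 1 the new defect is at most 0; for a quotient 2 it is at most 2 - √3 times the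
    -- defect two indices earlier, so an additive bound `C` persists.
    obtain hs | hs : s (M + j + 3) = 1 ∨ s (M + j + 3) = 2 := by omega
    · have e1' : (q (M + j + 3) : ℝ) = q (M + j + 2) + q (M + j + 1) := by
        rw [e1, hs]; push_cast; ring
      rw [e1']
      nlinarith
    · have e1' : (q (M + j + 3) : ℝ) = 2 * q (M + j + 2) + q (M + j + 1) := by
        rw [e1, hs]; push_cast; ring
      rw [e1']
      have e5 : (√3 - 1) / 2 * (2 * q (M + j + 2) + q (M + j + 1)) - q (M + j + 2) ≤
          (2 - √3) * ((√3 - 1) / 2 * q (M + j + 1) - q (M + j) : ℝ) := by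
        nlinarith
      have e6 : (2 - √3) * ((√3 - 1) / 2 * q (M + j + 1) - q (M + j) : ℝ) ≤ (2 - √3) * C :=
        mul_le_mul_of_nonneg_left ih (by linarith)
      nlinarith

/-- If the partial quotients are eventually at most `2`, then `δ(w) ≤ [1, 1, 2, 1, 2, 1, …]`. -/
lemma delta_le_of_le_two (h : SturmianData w a b s q) {M : ℕ} (hM : ∀ n ≥ M, s n ≤ 2) :
    delta w ≤ ENNReal.ofReal (√3) := by
  have h3 : √3 * √3 = 3 := Real.mul_self_sqrt (by norm_num)
  have hlo : (1.73 : ℝ) ≤ √3 := Real.le_sqrt_of_sq_le (by norm_num)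
  have hhi : √3 ≤ (1.74 : ℝ) := Real.sqrt_le_iff.2 (by norm_num)
  obtain ⟨C, hC⟩ := h.exists_defect_bound hM
  apply delta_le_of_forall_gt
  intro c hc
  have hq : Tendsto (fun n => q (n + 1)) atTop atTop :=
    tendsto_atTop_mono (fun n => (Nat.le_succ n).trans (h.le_q_succ n)) tendsto_id
  have hcl : Tendsto (fun n => centralLength q n 0) atTop atTop := by
    refine tendsto_atTop_mono (fun n => ?_) tendsto_id
    have h1 := h.le_q_succ n
    have h2 := h.q_pos n
    have h4 := h.centralLength_zero n
    simp only [id]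
    omega
  -- Only k = 0 and k = 1 are used: since s_{n+2} ≤ 2, the next block starts at k = 1 or k = 2. The
  -- gap from k = 1 has ratio at most about 3/2, so only k = 0 is critical.
  apply delta_le_of_chain (L := fun j => centralLength q (j / 2) (j % 2))
  · exact fun j => h.isPalLength_central _ _
      (le_trans (by omega) (h.pos (j / 2 + 2) (by omega)))
  · refine tendsto_atTop_mono (f := fun j => centralLength q (j / 2) 0) (fun j => ?_)
      (hcl.comp (Nat.tendsto_div_const_atTop two_ne_zero))
    rcases Nat.mod_two_eq_zero_or_one j with hj | hj
    · rw [hj]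
    · rw [hj, h.centralLength_succ]
      omega
  · have hlarge : ∀ᶠ n in atTop, ((√3 - 1) * C + 2 * c) / (c - √3) ≤ (q (n + 1) : ℝ) :=
      (tendsto_natCast_atTop_atTop.comp hq).eventually (eventually_ge_atTop _)
    -- The first threshold makes `C` and the `-2` negligible in the gap from k = 0, the second
    -- absorbs the `-2` in the gap from k = 1.
    have hlarge' : ∀ᶠ n in atTop, 20 * c ≤ (q (n + 1) : ℝ) :=
      (tendsto_natCast_atTop_atTop.comp hq).eventually (eventually_ge_atTop _)
    have hev := (Nat.tendsto_div_const_atTop two_ne_zero).eventually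
      ((hlarge.and hlarge').and (eventually_ge_atTop M))
    filter_upwards [hev] with j hj
    obtain ⟨⟨hl, hl'⟩, hjM⟩ := hj
    generalize hn : j / 2 = n at *
    rw [div_le_iff₀ (by linarith)] at hl
    have e0 := h.centralLength_zero n
    have e1 := h.centralLength_succ n 0
    have e0' : (centralLength q n 0 : ℝ) + 2 = q (n + 1) + q n := by exact_mod_cast e0
    have e1' : (centralLength q n 1 : ℝ) = centralLength q n 0 + q (n + 1) := by
      exact_mod_cast e1
    have hCn := hC n hjM
    have p0 : (0 : ℝ) ≤ q n := by positivity
    rcases Nat.mod_two_eq_zero_or_one j with hj | hj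
    · rw [show (j + 1) / 2 = n by omega, show (j + 1) % 2 = 1 by omega, hj, e1',
        show (centralLength q n 0 : ℝ) = q (n + 1) + q n - 2 by linarith]
      nlinarith
    · rw [show (j + 1) / 2 = n + 1 by omega, show (j + 1) % 2 = 0 by omega, hj,
        ← h.centralLength_top]
      have hs1 := h.pos (n + 2) (by omega)
      have hs2 := hM (n + 2) (by omega)
      obtain hs | hs : s (n + 2) = 1 ∨ s (n + 2) = 2 := by omega
      · rw [hs]
        have : (0 : ℝ) ≤ centralLength q n 1 := by positivity
        nlinarith
      · rw [hs, h.centralLength_succ]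
        push_cast
        rw [e1', show (centralLength q n 0 : ℝ) = q (n + 1) + q n - 2 by linarith]
        nlinarith

end SturmianData

/-- The gap in the spectrum `𝒟'`. -/
theorem not_mem_specD'_of_mem_gap {x : ℝ≥0∞} (hx : x ∈ specD') :
    ¬ (ENNReal.ofReal (√3) < x ∧ x < ENNReal.ofReal ((7 + √13) / 6)) := by
  rintro ⟨h1, h2⟩
  obtain ⟨A, w, hw | hw, rfl⟩ := hx
  · exact absurd (hw.delta_le (c := √3) (Real.lt_sqrt_of_sq_lt (by norm_num))) (not_le.2 h1)
  · obtain ⟨a, b, s, q, h⟩ := hw.exists_data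
    by_cases h3 : ∀ M, ∃ n ≥ M, 3 ≤ s n
    · exact absurd (h.le_delta_of_three_le h3) (not_le.2 h2)
    · push Not at h3
      obtain ⟨M, hM⟩ := h3
      exact absurd (h.delta_le_of_le_two (M := M) fun n hn => by have := hM n hn; omega)
        (not_le.2 h1)

/-! ### Continuing a palindromic prefix: closures and the skipping move -/

lemma isPalLength_congr {u : ℕ → A} {n : ℕ} (h : ∀ k < n, w k = u k) :
    IsPalLength w n ↔ IsPalLength u n := by
  unfold IsPalLength pre
  rw [List.map_congr_left fun k hk => h k (List.mem_range.1 hk)]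

/-- A palindromic prefix continued as after a shorter palindromic prefix. -/
lemma IsPalLength.extend_of_pal {N t : ℕ} (hN : IsPalLength w N) (ht : t ≤ N)
    (hm : IsPalLength w (N - t)) (hw : ∀ k, N ≤ k → k < N + t → w k = w (k - t)) :
    IsPalLength w (N + t) := by
  refine hN.extend (by omega) fun i hi => ?_
  rcases Nat.lt_or_ge (i + t) N with h1 | h1
  · exact IsPalLength.period (m := N - t) (by rwa [Nat.sub_add_cancel ht]) hm i (by omega)
  · rw [hw _ h1 (by omega), Nat.add_sub_cancel]

/-- The prefix of length `N` of `w` is a palindrome, and `N - p` and `N - q` are the lengths of the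
longest shorter palindromic prefixes that are followed by the letters `x` and `y`. -/
structure PalState (w : ℕ → A) (x y : A) (N p q : ℕ) : Prop where
  p_pos : 0 < p
  q_pos : 0 < q
  p_le : p ≤ N
  q_le : q ≤ N
  pal : IsPalLength w N
  pal_p : IsPalLength w (N - p)
  pal_q : IsPalLength w (N - q)
  letter_p : w (N - p) = x
  letter_q : w (N - q) = y
  max_p : ∀ m, N - p < m → m < N → IsPalLength w m → w m ≠ x
  max_q : ∀ m, N - q < m → m < N → IsPalLength w m → w m ≠ y

namespace PalState

variable {x y : A} {N p q : ℕ}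

lemma swap (h : PalState w x y N p q) : PalState w y x N q p :=
  ⟨h.q_pos, h.p_pos, h.q_le, h.p_le, h.pal, h.pal_q, h.pal_p, h.letter_q, h.letter_p, h.max_q,
    h.max_p⟩

lemma congr {u : ℕ → A} (h : PalState u x y N p q) (hu : ∀ k < N, w k = u k) :
    PalState w x y N p q := by
  have h1 := h.p_pos
  have h2 := h.q_pos
  have h3 := h.p_le
  have h4 := h.q_le
  have key : ∀ m ≤ N, IsPalLength w m ↔ IsPalLength u m := fun m hm =>
    isPalLength_congr fun k hk => hu k (by omega)
  exact
    { p_pos := h1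
      q_pos := h2
      p_le := h3
      q_le := h4
      pal := (key _ le_rfl).2 h.pal
      pal_p := (key _ (by omega)).2 h.pal_p
      pal_q := (key _ (by omega)).2 h.pal_q
      letter_p := by rw [hu _ (by omega)]; exact h.letter_p
      letter_q := by rw [hu _ (by omega)]; exact h.letter_q
      max_p := fun m hm hm' hp => by
        rw [hu _ hm']; exact h.max_p m hm hm' ((key _ hm'.le).1 hp)
      max_q := fun m hm hm' hp => by
        rw [hu _ hm']; exact h.max_q m hm hm' ((key _ hm'.le).1 hp) }

lemma letter (h : PalState w x y N p q) (hw : ∀ k, N ≤ k → k < N + p → w k = w (k - p)) :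
    w N = x := by
  rw [hw N le_rfl (by have := h.p_pos; omega), h.letter_p]

/-- An intermediate palindromic prefix would reflect in `N` to one longer than `N - p` and followed
by `x`, against the maximality of `N - p`. -/
lemma gap (h : PalState w x y N p q) (hw : ∀ k, N ≤ k → k < N + p → w k = w (k - p)) (m : ℕ)
    (h1 : N < m) (h2 : m < N + p) : ¬ IsPalLength w m := by
  intro hm
  have h3 := h.p_le
  obtain ⟨h4, h5⟩ := h.pal.reflect_sub hm h1 (by omega)
  exact h.max_p _ (by omega) (by omega) h4 (h5.trans (h.letter hw))

/-- Palindromic closure of the current palindromic prefix followed by `x`. -/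
lemma closure (h : PalState w x y N p q) (hxy : x ≠ y)
    (hw : ∀ k, N ≤ k → k < N + p → w k = w (k - p)) : PalState w x y (N + p) p (p + q) := by
  have h1 := h.p_pos
  have h2 := h.q_pos
  have h3 := h.p_le
  have h4 := h.q_le
  exact
    { p_pos := h1
      q_pos := by omega
      p_le := by omega
      q_le := by omega
      pal := h.pal.extend_of_pal h3 h.pal_p hw
      pal_p := by rw [Nat.add_sub_cancel]; exact h.pal
      pal_q := by rw [show N + p - (p + q) = N - q by omega]; exact h.pal_q
      letter_p := by rw [Nat.add_sub_cancel]; exact h.letter hw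
      letter_q := by rw [show N + p - (p + q) = N - q by omega]; exact h.letter_q
      max_p := fun m hm hm' hp => absurd hp (h.gap hw m (by omega) hm')
      max_q := fun m hm hm' hp => by
        rcases lt_trichotomy m N with h5 | rfl | h5
        · exact h.max_q m (by omega) h5 hp
        · rw [h.letter hw]; exact hxy
        · exact absurd hp (h.gap hw m h5 hm') }

/-- The situation in which the current palindromic prefix may be continued beyond its palindromic
closure: `N - (2 * p - q)` is the second longest palindromic prefix followed by `x`. -/
structure Second (w : ℕ → A) (x : A) (N p q : ℕ) : Prop where
  lt : q < p
  le : 2 * p - q ≤ N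
  pal : IsPalLength w (N - (2 * p - q))
  letter : w (N - (2 * p - q)) = x
  max : ∀ m, N - (2 * p - q) < m → m < N → IsPalLength w m → w m = x → m = N - p

/-- Reflection in `N` leaves `N + p` as the only possible intermediate length. If it were
palindromic, reflecting the new endpoint in it would make `N + q` another one, which is impossible
as `q < p`. -/
lemma second_gap (h : PalState w x y N p q) (hs : Second w x N p q)
    (hw : ∀ k, N ≤ k → k < N + (2 * p - q) → w k = w (k - (2 * p - q))) (m : ℕ)
    (h1 : N < m) (h2 : m < N + (2 * p - q)) : ¬ IsPalLength w m := by
  have h3 := h.q_pos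
  have h4 := hs.lt
  have h5 := hs.le
  have h6 := h.p_le
  have hpal := h.pal.extend_of_pal h5 hs.pal hw
  have key : ∀ m, N < m → m < N + (2 * p - q) → IsPalLength w m → m = N + p := by
    intro m h1 h2 hm
    obtain ⟨h7, h8⟩ := h.pal.reflect_sub hm h1 (by omega)
    rw [hw N le_rfl (by omega), hs.letter] at h8
    have := hs.max _ (by omega) (by omega) h7 h8
    omega
  intro hm
  have e := key m h1 h2 hm
  subst e
  have h9 := key _ (by omega) (by omega) (hm.reflect_sub hpal h2 (by omega)).1
  omega

/-- Continuation of the current palindromic prefix as after the second longest palindromic prefix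
followed by `x`. -/
lemma second (h : PalState w x y N p q) (hxy : x ≠ y) (hs : Second w x N p q)
    (hw : ∀ k, N ≤ k → k < N + (2 * p - q) → w k = w (k - (2 * p - q))) :
    PalState w x y (N + (2 * p - q)) (2 * p - q) (2 * p) := by
  have h1 := h.p_pos
  have h2 := h.q_pos
  have h3 := h.p_le
  have h4 := h.q_le
  have h5 := hs.lt
  have hN : w N = x := by rw [hw N le_rfl (by omega), hs.letter]
  exact
    { p_pos := by omega
      q_pos := by omega
      p_le := by omega
      q_le := by omega
      pal := h.pal.extend_of_pal hs.le hs.pal hw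
      pal_p := by rw [Nat.add_sub_cancel]; exact h.pal
      pal_q := by rw [show N + (2 * p - q) - 2 * p = N - q by omega]; exact h.pal_q
      letter_p := by rw [Nat.add_sub_cancel]; exact hN
      letter_q := by rw [show N + (2 * p - q) - 2 * p = N - q by omega]; exact h.letter_q
      max_p := fun m hm hm' hp => absurd hp (h.second_gap hs hw m (by omega) hm')
      max_q := fun m hm hm' hp => by
        rcases lt_trichotomy m N with h5 | rfl | h5
        · exact h.max_q m (by omega) h5 hp
        · rw [hN]; exact hxy
        · exact absurd hp (h.second_gap hs hw m h5 hm') }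

/-- After palindromic closures with the letters `x`, `x`, `y` the second longest palindromic prefix
followed by `x` is known. -/
lemma second_of_closures (h : PalState w x y N p q) (hxy : x ≠ y)
    (hw1 : ∀ k, N ≤ k → k < N + p → w k = w (k - p))
    (hw2 : ∀ k, N + p ≤ k → k < N + p + p → w k = w (k - p))
    (hw3 : ∀ k, N + p + p ≤ k → k < N + p + p + (p + (p + q)) → w k = w (k - (p + (p + q)))) :
    Second w x (N + p + p + (p + (p + q))) (p + (p + (p + q))) (p + (p + q)) := by
  have s1 := h.closure hxy hw1
  -- The third closure adds `y`, so the roles of `p` and `q` are exchanged. The original `N` and `N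
  -- + p` become the two longest palindromic prefixes followed by `x`.
  have s2 := (s1.closure hxy hw2).swap
  have h1 := h.p_pos
  have e : N + p + p + (p + (p + q)) - (2 * (p + (p + (p + q))) - (p + (p + q))) = N := by omega
  refine ⟨by omega, by omega, ?_, ?_, ?_⟩
  · rw [e]; exact h.pal
  · rw [e]; exact h.letter hw1
  · intro m hm hm' hp hx
    rw [e] at hm
    rcases lt_trichotomy m (N + p) with h5 | rfl | h5
    · exact absurd hp (h.gap hw1 m hm h5)
    · omega
    rcases lt_trichotomy m (N + p + p) with h6 | rfl | h6
    · exact absurd hp (s1.gap hw2 m h5 h6)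
    · exact absurd (hx.symm.trans (s2.letter hw3)) hxy
    · exact absurd hp (s2.gap hw3 m h6 hm')

end PalState

/-! ### Words realizing sequences of steps -/

/-- The word with prescribed prefix in which the letters from position `N i` on, up to position
`N i + t i`, continue with period `t i`. -/
lemma exists_word_of_periods (u : ℕ → A) (N t : ℕ → ℕ) (h0 : 0 < N 0) (ht : ∀ i, 0 < t i)
    (hN : ∀ i, N (i + 1) = N i + t i) :
    ∃ w : ℕ → A, (∀ k < N 0, w k = u k) ∧
      ∀ i k, N i ≤ k → k < N i + t i → w k = w (k - t i) := by
  -- Stage `i + 1` keeps the first `N i` letters and continues them with period `t i`. Since `k < N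
  -- k`, the diagonal `W k k` is the limit of the stages.
  let W : ℕ → ℕ → A := fun i => Nat.rec u
    (fun i v k => if k < N i then v k else v (k - t i)) i
  have hW : ∀ i k, W (i + 1) k = if k < N i then W i k else W i (k - t i) := fun i k => rfl
  have hmono : StrictMono N := strictMono_nat_of_lt_succ fun i => by
    rw [hN]; exact Nat.lt_add_of_pos_right (ht i)
  have hpos : ∀ i, 0 < N i := fun i => lt_of_lt_of_le h0 (hmono.monotone (Nat.zero_le i))
  have hlt : ∀ k, k < N k := by
    intro k
    induction k with
    | zero => exact h0
    | succ k ih => rw [hN]; have := ht k; omega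
  have hst : ∀ i j k, k < N i → W (i + j) k = W i k := by
    intro i j k hk
    induction j with
    | zero => rfl
    | succ j ih =>
      rw [← add_assoc, hW, if_pos (lt_of_lt_of_le hk (hmono.monotone (Nat.le_add_right i j))), ih]
  have hw : ∀ i k, k < N i → W k k = W i k := by
    intro i k hk
    rcases le_total i k with h | h
    · obtain ⟨j, rfl⟩ := Nat.exists_eq_add_of_le h
      exact hst i j _ hk
    · obtain ⟨j, rfl⟩ := Nat.exists_eq_add_of_le h
      exact (hst k j _ (hlt k)).symm
  refine ⟨fun k => W k k, fun k hk => hw 0 k hk, fun i k h1 h2 => ?_⟩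
  have h3 := hpos i
  change W k k = W (k - t i) (k - t i)
  rw [hw (i + 1) k (by rw [hN]; exact h2), hW, if_neg (by omega),
    hw i (k - t i) (by have := ht i; omega)]

/-- The ways to continue a palindromic prefix: palindromic closure with the first or with the second
letter, or continuation as after the second longest palindromic prefix followed by the first
letter. -/
inductive Step
  | a
  | b
  | c

/-- The effect of a step on `N`, `p`, `q` as in `PalState`. -/
def Step.next : Step → ℕ × ℕ × ℕ → ℕ × ℕ × ℕ
  | .a, (N, p, q) => (N + p, p, p + q)
  | .b, (N, p, q) => (N + q, p + q, q)
  | .c, (N, p, q) => (N + (2 * p - q), 2 * p - q, 2 * p)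

/-- The sequence of the `N`, `p`, `q` defined by a sequence of steps. -/
def stateSeq (d : ℕ → Step) : ℕ → ℕ × ℕ × ℕ
  | 0 => (32, 21, 13)
  | i + 1 => (d i).next (stateSeq d i)

/-- The prefix of length `32` of the Fibonacci word. -/
def fibSeed (k : ℕ) : Bool :=
  [false, true, false, false, true, false, true, false, false, true, false, false, true, false,
    true, false, false, true, false, true, false, false, true, false, false, true, false, true,
    false, false, true, false].getD k false

/-- Since 32 = 21 + 13 - 2, the initial defect is 2; as 21/13 lies in [3/2, 7/4], the seed also
satisfies `RoundStart`. -/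
lemma palState_fibSeed : PalState fibSeed false true 32 21 13 where
  p_pos := by norm_num
  q_pos := by norm_num
  p_le := by norm_num
  q_le := by norm_num
  pal := by unfold IsPalLength; decide
  pal_p := by unfold IsPalLength; decide
  pal_q := by unfold IsPalLength; decide
  letter_p := rfl
  letter_q := rfl
  max_p := by
    intro m h1 h2
    unfold IsPalLength
    interval_cases m <;> decide
  max_q := by
    intro m h1 h2
    unfold IsPalLength
    interval_cases m <;> decide

/-- A step `c` occurs only after the steps `a`, `a`, `b`. -/
def Admissible (d : ℕ → Step) : Prop :=
  ∀ i, d i = .c → ∃ j, i = j + 3 ∧ d j = .a ∧ d (j + 1) = .a ∧ d (j + 2) = .b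

lemma stateSeq_succ (d : ℕ → Step) (i : ℕ) :
    stateSeq d (i + 1) = (d i).next (stateSeq d i) := rfl

/-- Only `c` is delicate: it follows `b`, after which `q < p`, so `2 * p - q` is not truncated and
is positive. -/
lemma stateSeq_pos {d : ℕ → Step} (hd : Admissible d) (i : ℕ) :
    0 < (stateSeq d i).2.1 ∧ 0 < (stateSeq d i).2.2 ∧
      (stateSeq d i).1 < (stateSeq d (i + 1)).1 := by
  have key : ∀ i, 0 < (stateSeq d i).2.1 → 0 < (stateSeq d i).2.2 →
      0 < (stateSeq d (i + 1)).2.1 ∧ 0 < (stateSeq d (i + 1)).2.2 ∧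
      (stateSeq d i).1 < (stateSeq d (i + 1)).1 := by
    intro i h1 h2
    rw [stateSeq_succ]
    cases hi : d i with
    | a =>
      generalize stateSeq d i = t at h1 h2 ⊢
      obtain ⟨N, p, q⟩ := t
      simp only [Step.next] at h1 h2 ⊢
      omega
    | b =>
      generalize stateSeq d i = t at h1 h2 ⊢
      obtain ⟨N, p, q⟩ := t
      simp only [Step.next] at h1 h2 ⊢
      omega
    | c =>
      obtain ⟨j, rfl, -, -, h3⟩ := hd i hi
      rw [stateSeq_succ, h3] at h1 h2 ⊢
      generalize stateSeq d (j + 2) = t at h1 h2 ⊢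
      obtain ⟨N, p, q⟩ := t
      simp only [Step.next] at h1 h2 ⊢
      omega
  have h : ∀ i, 0 < (stateSeq d i).2.1 ∧ 0 < (stateSeq d i).2.2 := by
    intro i
    induction i with
    | zero => simp [stateSeq]
    | succ i ih => exact ⟨(key i ih.1 ih.2).1, (key i ih.1 ih.2).2.1⟩
  exact ⟨(h i).1, (h i).2, (key i (h i).1 (h i).2).2.2⟩

/-- Every admissible sequence of steps is realized by a word, and the palindromic prefixes of this
word are those that the steps produce. -/
theorem exists_word_of_admissible {d : ℕ → Step} (hd : Admissible d) :
    ∃ w : ℕ → Bool, (∀ k < 32, w k = fibSeed k) ∧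
      ∀ i, PalState w false true (stateSeq d i).1 (stateSeq d i).2.1
      (stateSeq d i).2.2 ∧ ∀ m, (stateSeq d i).1 < m → m < (stateSeq d (i + 1)).1 →
        ¬ IsPalLength w m := by
  have hpos := stateSeq_pos hd
  obtain ⟨w, hw0, hw⟩ := exists_word_of_periods fibSeed (fun i => (stateSeq d i).1)
    (fun i => (stateSeq d (i + 1)).1 - (stateSeq d i).1) (by simp [stateSeq])
    (fun i => Nat.sub_pos_of_lt (hpos i).2.2)
    (fun i => (Nat.add_sub_cancel' (hpos i).2.2.le).symm)
  have hxy : false ≠ true := Bool.false_ne_true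
  have hwa : ∀ i N p q, stateSeq d i = (N, p, q) → d i = .a →
      ∀ k, N ≤ k → k < N + p → w k = w (k - p) := by
    intro i N p q h1 h2 k h3 h4
    have := hw i k
    simp only [stateSeq_succ, h1, h2, Step.next, Nat.add_sub_cancel_left] at this
    exact this h3 h4
  have hwb : ∀ i N p q, stateSeq d i = (N, p, q) → d i = .b →
      ∀ k, N ≤ k → k < N + q → w k = w (k - q) := by
    intro i N p q h1 h2 k h3 h4
    have := hw i k
    simp only [stateSeq_succ, h1, h2, Step.next, Nat.add_sub_cancel_left] at this
    exact this h3 h4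
  have hwc : ∀ i N p q, stateSeq d i = (N, p, q) → d i = .c →
      ∀ k, N ≤ k → k < N + (2 * p - q) → w k = w (k - (2 * p - q)) := by
    intro i N p q h1 h2 k h3 h4
    have := hw i k
    simp only [stateSeq_succ, h1, h2, Step.next, Nat.add_sub_cancel_left] at this
    exact this h3 h4
  -- The hypothesis covers all earlier states because a step `c` needs the state three steps back,
  -- before `a`, `a`, `b`.
  have main : ∀ i, (∀ j ≤ i, ∀ N p q, stateSeq d j = (N, p, q) → PalState w false true N p q) →
      ∀ N p q, stateSeq d i = (N, p, q) →
      (∀ N' p' q', stateSeq d (i + 1) = (N', p', q') → PalState w false true N' p' q' ∧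
        ∀ m, N < m → m < N' → ¬ IsPalLength w m) := by
    intro i ih N p q hi N' p' q' hi'
    have hs := ih i le_rfl N p q hi
    rw [stateSeq_succ, hi] at hi'
    cases hdi : d i with
    | a =>
      rw [hdi] at hi'
      simp only [Step.next, Prod.mk.injEq] at hi'
      obtain ⟨rfl, rfl, rfl⟩ := hi'
      have := hwa i _ _ _ hi hdi
      exact ⟨hs.closure hxy this, hs.gap this⟩
    | b =>
      rw [hdi] at hi'
      simp only [Step.next, Prod.mk.injEq] at hi'
      obtain ⟨rfl, rfl, rfl⟩ := hi'
      have := hwb i _ _ _ hi hdi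
      rw [add_comm p q]
      exact ⟨(hs.swap.closure hxy.symm this).swap, hs.swap.gap this⟩
    | c =>
      rw [hdi] at hi'
      simp only [Step.next, Prod.mk.injEq] at hi'
      obtain ⟨rfl, rfl, rfl⟩ := hi'
      have := hwc i _ _ _ hi hdi
      obtain ⟨j, rfl, ha1, ha2, hb⟩ := hd i hdi
      rcases hj : stateSeq d j with ⟨M, α, β⟩
      have e1 : stateSeq d (j + 1) = (M + α, α, α + β) := by
        rw [stateSeq_succ, hj, ha1]; rfl
      have e2 : stateSeq d (j + 2) = (M + α + α, α, α + (α + β)) := by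
        rw [stateSeq_succ, e1, ha2]; rfl
      have e3 : stateSeq d (j + 3) = (M + α + α + (α + (α + β)), α + (α + (α + β)),
          α + (α + β)) := by
        rw [stateSeq_succ, e2, hb]; rfl
      rw [hi, Prod.mk.injEq, Prod.mk.injEq] at e3
      obtain ⟨rfl, rfl, rfl⟩ := e3
      have hsec := (ih j (by omega) _ _ _ hj).second_of_closures hxy (hwa _ _ _ _ hj ha1)
        (hwa _ _ _ _ e1 ha2) (hwb _ _ _ _ e2 hb)
      exact ⟨hs.second hxy hsec this, hs.second_gap hsec this⟩
  have hall : ∀ i, ∀ N p q, stateSeq d i = (N, p, q) → PalState w false true N p q := by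
    intro i
    induction i using Nat.strong_induction_on with
    | _ i ih =>
    cases i with
    | zero =>
      intro N p q h
      simp only [stateSeq, Prod.mk.injEq] at h
      obtain ⟨rfl, rfl, rfl⟩ := h
      exact palState_fibSeed.congr hw0
    | succ i =>
      intro N p q h
      exact (main i (fun j hj => ih j (by omega)) _ _ _ rfl N p q h).1
  exact ⟨w, hw0, fun i => ⟨hall i _ _ _ rfl, (main i (fun j _ => hall j) _ _ _ rfl _ _ _ rfl).2⟩⟩

/-! ### The periodic sequence of steps -/

/-- The steps `(ab)^k (aab)^k c b`, repeated periodically. -/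
def roundStep (k i : ℕ) : Step :=
  if i % (5 * k + 2) < 2 * k then
    if i % (5 * k + 2) % 2 = 0 then .a else .b
  else if i % (5 * k + 2) < 5 * k then
    if (i % (5 * k + 2) - 2 * k) % 3 = 2 then .b else .a
  else if i % (5 * k + 2) = 5 * k then .c else .b

section roundStep

variable {k i j l : ℕ}

lemma add_mod_of_mod_eq_zero {n : ℕ} (hi : i % n = 0) (hj : j < n) : (i + j) % n = j := by
  rw [Nat.add_mod, hi, zero_add, Nat.mod_mod, Nat.mod_eq_of_lt hj]

lemma roundStep_first_a (hi : i % (5 * k + 2) = 0) (hl : l < k) :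
    roundStep k (i + 2 * l) = .a := by
  rw [roundStep, add_mod_of_mod_eq_zero hi (by omega), if_pos (by omega), if_pos (by omega)]

lemma roundStep_first_b (hi : i % (5 * k + 2) = 0) (hl : l < k) :
    roundStep k (i + 2 * l + 1) = .b := by
  rw [roundStep, add_assoc, add_mod_of_mod_eq_zero hi (by omega), if_pos (by omega),
    if_neg (by omega)]

lemma roundStep_second_a (hi : i % (5 * k + 2) = 0) (hl : l < k) :
    roundStep k (i + 2 * k + 3 * l) = .a := by
  rw [roundStep, add_assoc, add_mod_of_mod_eq_zero hi (by omega), if_neg (by omega),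
    if_pos (by omega), if_neg (by omega)]

lemma roundStep_second_a' (hi : i % (5 * k + 2) = 0) (hl : l < k) :
    roundStep k (i + 2 * k + 3 * l + 1) = .a := by
  rw [roundStep, add_assoc, add_assoc, add_mod_of_mod_eq_zero hi (by omega), if_neg (by omega),
    if_pos (by omega), if_neg (by omega)]

lemma roundStep_second_b (hi : i % (5 * k + 2) = 0) (hl : l < k) :
    roundStep k (i + 2 * k + 3 * l + 2) = .b := by
  rw [roundStep, add_assoc, add_assoc, add_mod_of_mod_eq_zero hi (by omega), if_neg (by omega),
    if_pos (by omega), if_pos (by omega)]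

lemma roundStep_c (hi : i % (5 * k + 2) = 0) : roundStep k (i + 2 * k + 3 * k) = .c := by
  rw [roundStep, add_assoc, add_mod_of_mod_eq_zero hi (by omega), if_neg (by omega),
    if_neg (by omega), if_pos (by omega)]

lemma roundStep_last (hi : i % (5 * k + 2) = 0) : roundStep k (i + 2 * k + 3 * k + 1) = .b := by
  rw [roundStep, add_assoc, add_assoc, add_mod_of_mod_eq_zero hi (by omega), if_neg (by omega),
    if_neg (by omega), if_neg (by omega)]

lemma admissible_roundStep (hk : 0 < k) : Admissible (roundStep k) := by
  intro i hi
  have h1 : i % (5 * k + 2) = 5 * k := by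
    unfold roundStep at hi
    split_ifs at hi
    assumption
  set i₀ := i - 5 * k with hi₀
  have h2 := Nat.mod_le i (5 * k + 2)
  have h3 : i₀ % (5 * k + 2) = 0 := by
    exact Nat.sub_mod_eq_zero_of_mod_eq (by rw [h1, Nat.mod_eq_of_lt (by omega)])
  refine ⟨i - 3, by omega, ?_, ?_, ?_⟩
  · rw [show i - 3 = i₀ + 2 * k + 3 * (k - 1) by omega]
    exact roundStep_second_a h3 (by omega)
  · rw [show i - 3 + 1 = i₀ + 2 * k + 3 * (k - 1) + 1 by omega]
    exact roundStep_second_a' h3 (by omega)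
  · rw [show i - 3 + 2 = i₀ + 2 * k + 3 * (k - 1) + 2 by omega]
    exact roundStep_second_b h3 (by omega)

end roundStep

/-! ### Growth estimates along one round -/

/-- Real sequences `N`, `P`, `Q` that follow the steps `d`. -/
structure Follows (d : ℕ → Step) (N P Q : ℕ → ℝ) : Prop where
  pos_P : ∀ i, 0 < P i
  pos_Q : ∀ i, 0 < Q i
  a : ∀ i, d i = .a → N (i + 1) = N i + P i ∧ P (i + 1) = P i ∧ Q (i + 1) = P i + Q i
  b : ∀ i, d i = .b → N (i + 1) = N i + Q i ∧ P (i + 1) = P i + Q i ∧ Q (i + 1) = Q i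
  c : ∀ i, d i = .c →
    N (i + 1) = N i + (2 * P i - Q i) ∧ P (i + 1) = 2 * P i - Q i ∧ Q (i + 1) = 2 * P i

lemma follows_stateSeq {d : ℕ → Step} (hd : Admissible d) :
    Follows d (fun i => (stateSeq d i).1) (fun i => (stateSeq d i).2.1)
      (fun i => (stateSeq d i).2.2) where
  pos_P i := by exact_mod_cast (stateSeq_pos hd i).1
  pos_Q i := by exact_mod_cast (stateSeq_pos hd i).2.1
  a i hi := by
    rw [stateSeq_succ, hi]
    rcases stateSeq d i with ⟨N, p, q⟩
    simp [Step.next]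
  b i hi := by
    rw [stateSeq_succ, hi]
    rcases stateSeq d i with ⟨N, p, q⟩
    simp [Step.next]
  c i hi := by
    have h := (stateSeq_pos hd i).2.2
    rw [stateSeq_succ, hi] at h ⊢
    generalize stateSeq d i = t at h ⊢
    obtain ⟨N, p, q⟩ := t
    simp only [Step.next] at h ⊢
    have h1 : q ≤ 2 * p := by omega
    push_cast [Nat.cast_sub h1]
    simp

namespace Follows

variable {d : ℕ → Step} {N P Q : ℕ → ℝ} {r : ℝ} {i k : ℕ}

/-- The invariant at the beginning of each round; `P i + Q i - N i` is the defect from the Sturmian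
case, up to a constant. -/
structure RoundStart (N P Q : ℕ → ℝ) (i : ℕ) : Prop where
  lower : 3 / 2 * Q i ≤ P i
  upper : P i ≤ 7 / 4 * Q i
  nonneg : N i ≤ P i + Q i
  small : 10 * (P i + Q i - N i) ≤ P i + Q i

/-- A pair `ab` preserves the defect and at least doubles `P + Q`, so the relative defect halves. It
maps the range [3/2, 7/4] of `P / Q` into itself, and there all gap ratios are at most 1.73. -/
lemma first_phase (h : Follows d N P Q) (hr : 1.73 ≤ r) (h0 : RoundStart N P Q i)
    (ha : ∀ l < k, d (i + 2 * l) = .a) (hb : ∀ l < k, d (i + 2 * l + 1) = .b) :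
    ∀ l ≤ k, (3 / 2 * Q (i + 2 * l) ≤ P (i + 2 * l) ∧ P (i + 2 * l) ≤ 7 / 4 * Q (i + 2 * l) ∧
      N (i + 2 * l) ≤ P (i + 2 * l) + Q (i + 2 * l) ∧
      10 * 2 ^ l * (P (i + 2 * l) + Q (i + 2 * l) - N (i + 2 * l)) ≤
        P (i + 2 * l) + Q (i + 2 * l)) ∧
      ∀ j < 2 * l, N (i + j + 1) ≤ r * N (i + j) := by
  intro l hl
  induction l with
  | zero => exact ⟨⟨h0.lower, h0.upper, h0.nonneg, by simpa using h0.small⟩, by simp⟩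
  | succ l ih =>
    obtain ⟨⟨h1, h2, h3, h4⟩, h5⟩ := ih (by omega)
    obtain ⟨a1, a2, a3⟩ := h.a _ (ha l (by omega))
    obtain ⟨b1, b2, b3⟩ := h.b _ (hb l (by omega))
    have hQ := h.pos_Q (i + 2 * l)
    have hpow : (1 : ℝ) ≤ 2 ^ l := one_le_pow₀ (by norm_num)
    rw [a1, a3] at b1
    rw [a2, a3] at b2
    rw [a3] at b3
    rw [show i + 2 * (l + 1) = i + 2 * l + 1 + 1 by ring]
    set p := P (i + 2 * l)
    set q := Q (i + 2 * l)
    set n := N (i + 2 * l)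
    have h6 : 10 * (p + q - n) ≤ p + q := by
      have : 0 ≤ (2 ^ l - 1) * (p + q - n) := mul_nonneg (by linarith) (by linarith)
      nlinarith
    refine ⟨⟨by linarith, by linarith, by linarith, ?_⟩, ?_⟩
    · rw [b1, b2, b3, pow_succ]
      have : 10 * (2 ^ l * 2) * (p + (p + q) + (p + q) - (n + p + (p + q))) =
        2 * (10 * 2 ^ l * (p + q - n)) := by ring
      rw [this]
      linarith
    · intro j hj
      rcases lt_trichotomy j (2 * l) with h7 | rfl | h7
      · exact h5 j h7
      · rw [a1]
        have : 1.73 * n ≤ r * n := mul_le_mul_of_nonneg_right hr (by linarith)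
        linarith
      · rw [show j = 2 * l + 1 by omega, ← add_assoc, b1, a1]
        have : 1.73 * (n + p) ≤ r * (n + p) := mul_le_mul_of_nonneg_right hr (by linarith)
        linarith

/-- The block `aab` sends (p,q) to (3p+q, 2p+q). The form D = p - (√3+1)/2·q is an eigenform with
eigenvalue 2 - √3, so D stays positive while D/q shrinks at a rate between 1/20 and 1/2. Positivity
of D keeps the gap of `b` below √3 up to the defect and provides the later excess over √3. -/
lemma second_phase (h : Follows d N P Q) {τ : ℝ} (hτ : τ ≤ 1 / 10) (hr : √3 + τ ≤ r)
    (hr2 : r ≤ 2) (h1 : 3 / 2 * Q i ≤ P i) (h2 : P i ≤ 7 / 4 * Q i) (h3 : N i ≤ P i + Q i)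
    (h4 : P i + Q i - N i ≤ τ * (P i + Q i))
    (ha : ∀ l < k, d (i + 3 * l) = .a) (ha' : ∀ l < k, d (i + 3 * l + 1) = .a)
    (hb : ∀ l < k, d (i + 3 * l + 2) = .b) :
    ∀ l ≤ k, (P (i + 3 * l) ≤ 7 / 4 * Q (i + 3 * l) ∧
      1 / 10 * (1 / 20) ^ l * Q (i + 3 * l) ≤ P (i + 3 * l) - (√3 + 1) / 2 * Q (i + 3 * l) ∧
      P (i + 3 * l) - (√3 + 1) / 2 * Q (i + 3 * l) ≤ (1 / 2) ^ l * Q (i + 3 * l) ∧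
      N (i + 3 * l) ≤ P (i + 3 * l) + Q (i + 3 * l) ∧
      P (i + 3 * l) + Q (i + 3 * l) - N (i + 3 * l) ≤ τ * (P (i + 3 * l) + Q (i + 3 * l))) ∧
      ∀ j < 3 * l, N (i + j + 1) ≤ r * N (i + j) := by
  have hs : √3 * √3 = 3 := Real.mul_self_sqrt (by norm_num)
  have hlo : (1.73 : ℝ) ≤ √3 := Real.le_sqrt_of_sq_le (by norm_num)
  have hhi : √3 ≤ (1.7321 : ℝ) := Real.sqrt_le_iff.2 (by norm_num)
  intro l hl
  induction l with
  | zero =>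
    have hQ := h.pos_Q i
    simp only [mul_zero, add_zero, pow_zero]
    refine ⟨⟨h2, by nlinarith, by nlinarith, h3, h4⟩, by simp⟩
  | succ l ih =>
    obtain ⟨⟨c1, c2, c3, c4, c5⟩, c6⟩ := ih (by omega)
    obtain ⟨a1, a2, a3⟩ := h.a _ (ha l (by omega))
    obtain ⟨a1', a2', a3'⟩ := h.a _ (ha' l (by omega))
    obtain ⟨b1, b2, b3⟩ := h.b _ (hb l (by omega))
    have hQ := h.pos_Q (i + 3 * l)
    rw [a1, a2] at a1'
    rw [a2] at a2'
    rw [a2, a3] at a3'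
    change N (i + 3 * l + 2) = _ at a1'
    change P (i + 3 * l + 2) = _ at a2'
    change Q (i + 3 * l + 2) = _ at a3'
    rw [a1', a3'] at b1
    rw [a2', a3'] at b2
    rw [a3'] at b3
    rw [show i + 3 * (l + 1) = i + 3 * l + 2 + 1 by ring]
    have e1 : ∀ j < 3 * (l + 1), j < 3 * l ∨ j = 3 * l ∨ j = 3 * l + 1 ∨ j = 3 * l + 2 := by
      intro j hj
      omega
    set p := P (i + 3 * l)
    set q := Q (i + 3 * l)
    set n := N (i + 3 * l)
    have hx : (0 : ℝ) < (1 / 20) ^ l := by positivity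
    have hy : (0 : ℝ) < (1 / 2) ^ l := by positivity
    set x : ℝ := (1 / 20) ^ l
    set y : ℝ := (1 / 2) ^ l
    have hxq := mul_pos hx hQ
    have hyq := mul_pos hy hQ
    set D := p - (√3 + 1) / 2 * q with hD
    have hD0 : 0 < D := by linarith
    have hDp : 1.365 * q ≤ p := by nlinarith
    have hD' : p + (p + (p + q)) - (√3 + 1) / 2 * (p + (p + q)) = (2 - √3) * D := by
      rw [hD]; linear_combination (-(q / 2)) * hs
    have hpq : 0 < p + q := by linarith
    have c5' : 0 ≤ τ := by
      by_contra! hneg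
      have := mul_neg_of_neg_of_pos hneg hpq
      linarith
    have c7 : p + q - n ≤ 1 / 10 * (p + q) :=
      c5.trans (mul_le_mul_of_nonneg_right hτ hpq.le)
    rw [b1, b2, b3, hD']
    refine ⟨⟨by linarith, ?_, ?_, by linarith, ?_⟩, ?_⟩
    · rw [pow_succ]
      have f1 : x * (p + (p + q)) ≤ x * (5 * q) := mul_le_mul_of_nonneg_left (by linarith) hx.le
      have f2 : 1 / 4 * D ≤ (2 - √3) * D := mul_le_mul_of_nonneg_right (by linarith) hD0.le
      change 1 / 10 * (x * (1 / 20)) * (p + (p + q)) ≤ _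
      linarith
    · rw [pow_succ]
      have f1 : y * q ≤ y * (p + (p + q)) := mul_le_mul_of_nonneg_left (by linarith) hy.le
      have f2 : (2 - √3) * D ≤ 1 / 2 * D := mul_le_mul_of_nonneg_right (by linarith) hD0.le
      change _ ≤ y * (1 / 2) * (p + (p + q))
      linarith
    · have f1 : τ * (p + q) ≤ τ * (p + (p + q) + (p + (p + q))) :=
        mul_le_mul_of_nonneg_left (by linarith) c5'
      have f2 : 0 ≤ τ * p := mul_nonneg c5' (by linarith)
      linarith
    · intro j hj
      have hlow : ∀ z : ℝ, 0 ≤ z → 1.73 * z ≤ r * z := fun z hz =>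
        mul_le_mul_of_nonneg_right (by linarith) hz
      rcases e1 j hj with e | rfl | rfl | rfl
      · exact c6 j e
      · rw [a1]
        have := hlow n (by linarith)
        linarith
      · rw [← add_assoc]
        rw [a1]
        change N (i + 3 * l + 2) ≤ _
        rw [a1']
        have := hlow (n + p) (by linarith)
        linarith
      · rw [← add_assoc, b1, a1']
        have e2 : (√3 + τ) * (n + p + p) ≤ r * (n + p + p) :=
          mul_le_mul_of_nonneg_right hr (by linarith)
        -- At zero defect the gap of `b` has ratio (5p+2q)/(3p+q), which is at most √3 exactly when
        -- D ≥ 0.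
        have e3 : 0 ≤ (3 * √3 - 5) * D := mul_nonneg (by linarith) hD0.le
        have e4 : (3 * √3 - 5) * D = (3 * √3 - 5) * p - (2 - √3) * q := by
          rw [hD]; linear_combination (-(3 / 2 * q)) * hs
        have e5 : (√3 - 1) * (p + q - n) ≤ 1 * (τ * (p + q)) :=
          mul_le_mul (by linarith) c5 (by linarith) (by norm_num)
        have e6 : τ * (p + q) ≤ τ * (n + p + p) := mul_le_mul_of_nonneg_left (by linarith) c5'
        linarith

/-- The excess of the gap of `c` over √3 splits into (√3-1) times the defect and (3-√3) D. Both
terms are nonnegative and small, and the second is bounded below through `η`. The final `b` gives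
P/Q = 2 - q/(2p), back in [3/2, 7/4]. -/
lemma last_phase (h : Follows d N P Q) {σ η : ℝ} (hσ : σ ≤ 1 / 50) (hr : √3 + 2 * σ ≤ r)
    (hη : 0 < η)
    (h1 : η * Q i ≤ P i - (√3 + 1) / 2 * Q i) (h2 : P i - (√3 + 1) / 2 * Q i ≤ σ * Q i)
    (h3 : N i ≤ P i + Q i) (h4 : P i + Q i - N i ≤ σ / 10 * (P i + Q i))
    (hc : d i = .c) (hb : d (i + 1) = .b) :
    RoundStart N P Q (i + 2) ∧ N (i + 1) ≤ r * N i ∧ N (i + 2) ≤ r * N (i + 1) ∧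
      (√3 + η / 3) * N i ≤ N (i + 1) := by
  have hs : √3 * √3 = 3 := Real.mul_self_sqrt (by norm_num)
  have hlo : (1.73 : ℝ) ≤ √3 := Real.le_sqrt_of_sq_le (by norm_num)
  have hhi : √3 ≤ (1.7321 : ℝ) := Real.sqrt_le_iff.2 (by norm_num)
  obtain ⟨c1, c2, c3⟩ := h.c _ hc
  obtain ⟨b1, b2, b3⟩ := h.b _ hb
  have hQ := h.pos_Q i
  change N (i + 2) = _ at b1
  change P (i + 2) = _ at b2
  change Q (i + 2) = _ at b3
  rw [c1, c3] at b1
  rw [c2, c3] at b2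
  rw [c3] at b3
  set p := P i
  set q := Q i
  set n := N i
  set D := p - (√3 + 1) / 2 * q with hD
  have hηq := mul_pos hη hQ
  have hσ0 : 0 < σ := by
    by_contra! hneg
    nlinarith
  have hp1 : 1.365 * q ≤ p := by nlinarith
  have hp2 : p ≤ 1.4 * q := by nlinarith
  have h5 : p + q - n ≤ 1 / 100 * q := by nlinarith
  have e1 : (3 - √3) * D = (2 * p - q) - (√3 - 1) * (p + q) := by
    rw [hD]; nlinarith
  have e2 : (3 - √3) * D ≤ 1.27 * (σ * q) := by
    apply mul_le_mul (by linarith) h2 (by linarith) (by norm_num)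
  have e7 : n + (2 * p - q) = √3 * n + (√3 - 1) * (p + q - n) + (3 - √3) * D := by
    rw [e1]; ring
  refine ⟨⟨?_, ?_, ?_, ?_⟩, ?_, ?_, ?_⟩
  · rw [b2, b3]; linarith
  · rw [b2, b3]; linarith
  · rw [b1, b2, b3]; linarith
  · rw [b1, b2, b3]; linarith
  · rw [c1, e7]
    have e3 : (√3 + 2 * σ) * n ≤ r * n := mul_le_mul_of_nonneg_right hr (by linarith)
    have e4 : (√3 - 1) * (p + q - n) ≤ 0.74 * (σ / 10 * (p + q)) :=
      mul_le_mul (by linarith) h4 (by linarith) (by norm_num)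
    have e5 : σ * (2 * q) ≤ σ * n := mul_le_mul_of_nonneg_left (by linarith) hσ0.le
    have e6 : σ * (p + q) ≤ σ * (2.4 * q) := mul_le_mul_of_nonneg_left (by linarith) hσ0.le
    linarith
  · rw [b1, c1]
    have e3 : 1.73 * (n + (2 * p - q)) ≤ r * (n + (2 * p - q)) :=
      mul_le_mul_of_nonneg_right (by linarith) (by linarith)
    linarith
  · rw [c1, e7]
    have e3 : 0 ≤ (√3 - 1) * (p + q - n) := mul_nonneg (by linarith) (by linarith)
    have e4 : 1 * (η * q) ≤ (3 - √3) * D :=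
      mul_le_mul (by linarith) h1 hηq.le (by linarith)
    have e5 : η * n ≤ η * (2.4 * q) := mul_le_mul_of_nonneg_left (by linarith) hη.le
    linarith

end Follows

lemma Follows.round {k i : ℕ} {N P Q : ℕ → ℝ} {r : ℝ} (h : Follows (roundStep k) N P Q)
    (hk : (1 / 2 : ℝ) ^ k ≤ 1 / 50) (hr : √3 + 2 * (1 / 2) ^ k ≤ r) (hr2 : r ≤ 2)
    (hi : i % (5 * k + 2) = 0) (h0 : RoundStart N P Q i) :
    RoundStart N P Q (i + (5 * k + 2)) ∧ (∀ j < 5 * k + 2, N (i + j + 1) ≤ r * N (i + j)) ∧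
      (√3 + 1 / 10 * (1 / 20) ^ k / 3) * N (i + 5 * k) ≤ N (i + 5 * k + 1) := by
  have hlo : (1.73 : ℝ) ≤ √3 := Real.le_sqrt_of_sq_le (by norm_num)
  have hσ : (0 : ℝ) < (1 / 2) ^ k := by positivity
  obtain ⟨⟨a1, a2, a3, a4⟩, a5⟩ := h.first_phase (k := k) (r := r) (by linarith) h0
    (fun l hl => roundStep_first_a hi hl) (fun l hl => roundStep_first_b hi hl) k le_rfl
  have a4' : P (i + 2 * k) + Q (i + 2 * k) - N (i + 2 * k) ≤
      (1 / 2) ^ k / 10 * (P (i + 2 * k) + Q (i + 2 * k)) := by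
    have h2 : (0 : ℝ) < 2 ^ k := by positivity
    rw [one_div, inv_pow, inv_eq_one_div, div_div, div_mul_eq_mul_div, one_mul,
      le_div_iff₀ (by positivity)]
    linarith
  obtain ⟨⟨-, b2, b3, b4, b5⟩, b6⟩ := h.second_phase (k := k) (τ := (1 / 2) ^ k / 10) (r := r)
    (by linarith) (by linarith) hr2 a1 a2 a3 a4' (fun l hl => roundStep_second_a hi hl)
    (fun l hl => roundStep_second_a' hi hl) (fun l hl => roundStep_second_b hi hl) k le_rfl
  obtain ⟨c1, c2, c3, c4⟩ := h.last_phase (r := r) hk hr (by positivity) b2 b3 b4 b5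
    (roundStep_c hi) (roundStep_last hi)
  have e : i + 2 * k + 3 * k = i + 5 * k := by ring
  rw [e] at c1 c2 c3 c4
  refine ⟨c1, fun j hj => ?_, c4⟩
  rcases Nat.lt_or_ge j (2 * k) with h1 | h1
  · exact a5 j h1
  rcases Nat.lt_or_ge j (5 * k) with h2 | h2
  · have := b6 (j - 2 * k) (by omega)
    rwa [show i + 2 * k + (j - 2 * k) = i + j by omega] at this
  obtain rfl | rfl : j = 5 * k ∨ j = 5 * k + 1 := by omega
  · exact c2
  · exact c3

lemma Follows.rounds {k : ℕ} {N P Q : ℕ → ℝ} {r : ℝ} (h : Follows (roundStep k) N P Q)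
    (hk : (1 / 2 : ℝ) ^ k ≤ 1 / 50) (hr : √3 + 2 * (1 / 2) ^ k ≤ r) (hr2 : r ≤ 2)
    (h0 : RoundStart N P Q 0) :
    (∀ i, N (i + 1) ≤ r * N i) ∧ ∀ M, ∃ i ≥ M,
      (√3 + 1 / 10 * (1 / 20) ^ k / 3) * N i ≤ N (i + 1) := by
  have hstart : ∀ t, RoundStart N P Q (t * (5 * k + 2)) := by
    intro t
    induction t with
    | zero => simpa using h0
    | succ t ih =>
      rw [Nat.succ_mul]
      exact (h.round hk hr hr2 (Nat.mul_mod_left _ _) ih).1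
  have hround := fun t => h.round hk hr hr2 (Nat.mul_mod_left _ _) (hstart t)
  refine ⟨fun i => ?_, fun M => ?_⟩
  · have := (hround (i / (5 * k + 2))).2.1 (i % (5 * k + 2)) (Nat.mod_lt _ (by omega))
    rwa [mul_comm, Nat.div_add_mod] at this
  · refine ⟨M * (5 * k + 2) + 5 * k, ?_, (hround M).2.2⟩
    have : M * 1 ≤ M * (5 * k + 2) := Nat.mul_le_mul_left _ (by omega)
    omega

/-- There are words with abundant palindromic prefixes whose `δ` is larger than `√3` but
arbitrarily close to `√3`. -/
theorem exists_abundant_delta_near_sqrt_three {c : ℝ} (hc : √3 < c) :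
    ∃ w : ℕ → Bool, Abundant w ∧ ENNReal.ofReal (√3) < delta w ∧
      delta w ≤ ENNReal.ofReal c := by
  have hs0 : (0 : ℝ) ≤ √3 := Real.sqrt_nonneg 3
  have hhi : √3 ≤ (1.7321 : ℝ) := Real.sqrt_le_iff.2 (by norm_num)
  -- Capping the ratios at 2 makes the word abundant beyond the seed.
  set r := min c 2
  have hr : √3 < r := lt_min hc (by linarith)
  have hr2 : r ≤ 2 := min_le_right _ _
  obtain ⟨k, hk⟩ := exists_pow_lt_of_lt_one (show 0 < min (1 / 50) ((r - √3) / 2) from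
    lt_min (by norm_num) (by linarith)) (show (1 / 2 : ℝ) < 1 by norm_num)
  have hk1 : (1 / 2 : ℝ) ^ k ≤ 1 / 50 := hk.le.trans (min_le_left _ _)
  have hk2 : (1 / 2 : ℝ) ^ k ≤ (r - √3) / 2 := hk.le.trans (min_le_right _ _)
  have hk0 : 0 < k := by
    rcases Nat.eq_zero_or_pos k with rfl | h
    · norm_num at hk1
    · exact h
  have hd := admissible_roundStep hk0
  obtain ⟨w, hw0, hw⟩ := exists_word_of_admissible hd
  have hF := follows_stateSeq hd
  obtain ⟨hup, hlow⟩ := hF.rounds hk1 (by linarith) hr2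
    ⟨by norm_num [stateSeq], by norm_num [stateSeq], by norm_num [stateSeq],
      by norm_num [stateSeq]⟩
  set L : ℕ → ℕ := fun i => (stateSeq (roundStep k) i).1 with hL
  have hmono : StrictMono L := strictMono_nat_of_lt_succ fun i => (stateSeq_pos hd i).2.2
  have hpal : ∀ i, IsPalLength w (L i) := fun i => (hw i).1.pal
  refine ⟨w, ?_, ?_, ?_⟩
  · apply abundant_of_forall_exists
    intro M _
    -- Within the seed the palindromic prefixes of lengths 1, 3, 6, 11, 19, 32 suffice.
    rcases Nat.lt_or_ge M 32 with hM | hM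
    · have key : ∀ n ≤ 32, IsPalLength fibSeed n → IsPalLength w n := fun n hn h =>
        (isPalLength_congr fun m hm => hw0 m (by omega)).2 h
      have h1 : IsPalLength w 1 := key 1 (by norm_num) (by unfold IsPalLength; decide)
      have h3 : IsPalLength w 3 := key 3 (by norm_num) (by unfold IsPalLength; decide)
      have h6 : IsPalLength w 6 := key 6 (by norm_num) (by unfold IsPalLength; decide)
      have h11 : IsPalLength w 11 := key 11 (by norm_num) (by unfold IsPalLength; decide)
      have h19 : IsPalLength w 19 := key 19 (by norm_num) (by unfold IsPalLength; decide)
      have h32 : IsPalLength w 32 := hpal 0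
      rcases Nat.lt_or_ge M 1 with hM1 | hM1
      · exact ⟨1, h1, by omega, by omega⟩
      rcases Nat.lt_or_ge M 3 with hM3 | hM3
      · exact ⟨3, h3, by omega, by omega⟩
      rcases Nat.lt_or_ge M 6 with hM6 | hM6
      · exact ⟨6, h6, by omega, by omega⟩
      rcases Nat.lt_or_ge M 11 with hM11 | hM11
      · exact ⟨11, h11, by omega, by omega⟩
      rcases Nat.lt_or_ge M 19 with hM19 | hM19
      · exact ⟨19, h19, by omega, by omega⟩
      · exact ⟨32, h32, by omega, by omega⟩
    · obtain ⟨i, h1, h2⟩ : ∃ i, L i ≤ M ∧ M < L (i + 1) := by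
        have hex : ∃ n, M < L n := ⟨M + 1, lt_of_lt_of_le (Nat.lt_succ_self M) hmono.le_apply⟩
        have h1 := Nat.find_spec hex
        obtain ⟨i, hi⟩ : ∃ i, Nat.find hex = i + 1 := Nat.exists_eq_succ_of_ne_zero fun h0 => by
          rw [h0] at h1
          exact absurd h1 (not_lt.2 hM)
        exact ⟨i, not_lt.1 (Nat.find_min hex (by omega)), hi ▸ h1⟩
      refine ⟨L (i + 1), hpal _, h2, ?_⟩
      have h3 : (L (i + 1) : ℝ) ≤ 2 * L i :=
        (hup i).trans (mul_le_mul_of_nonneg_right hr2 (by positivity))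
      have h4 : L (i + 1) ≤ 2 * L i := by exact_mod_cast h3
      omega
  · have hη : (0 : ℝ) < 1 / 10 * (1 / 20) ^ k / 3 := by positivity
    refine lt_of_lt_of_le ((ENNReal.ofReal_lt_ofReal_iff (by positivity)).2
      (lt_add_of_pos_right (√3) hη)) (le_delta_of_gaps fun M => ?_)
    obtain ⟨i, hi, h1⟩ := hlow M
    refine ⟨L i, hi.le.trans hmono.le_apply, hpal i, fun n hn h2 => h1.trans ?_⟩
    have h3 : L (i + 1) ≤ n := by
      by_contra! h3
      exact (hw i).2 n h2 h3 hn
    exact_mod_cast h3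
  · exact (delta_le_of_chain hpal hmono.tendsto_atTop (Eventually.of_forall hup)).trans
      (ENNReal.ofReal_le_ofReal (min_le_left _ _))

/-! ### Continued fractions of the two endpoints -/

lemma contFract_get?_zero {x : ℝ} {m : ℕ} (h1 : (m : ℝ) < (Int.fract x)⁻¹)
    (h2 : (Int.fract x)⁻¹ < m + 1) : (GenContFract.of x).s.get? 0 = some ⟨1, (m : ℝ)⟩ := by
  have h0 : Int.fract x ≠ 0 := by
    intro h0
    rw [h0, inv_zero] at h1
    exact absurd h1 (not_lt.2 (Nat.cast_nonneg m))
  have h3 : ⌊(Int.fract x)⁻¹⌋ = (m : ℤ) := by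
    rw [Int.floor_eq_iff]
    exact ⟨by exact_mod_cast h1.le, by exact_mod_cast h2⟩
  have h4 := GenContFract.of_s_head h0
  rw [h3] at h4
  exact_mod_cast h4

lemma fract_eq_sub {x : ℝ} {m : ℕ} (h1 : (m : ℝ) ≤ x) (h2 : x < m + 1) :
    Int.fract x = x - m := by
  have h3 : ⌊x⌋ = (m : ℤ) := by
    rw [Int.floor_eq_iff]
    exact ⟨by exact_mod_cast h1, by exact_mod_cast h2⟩
  rw [Int.fract, h3, Int.cast_natCast]

/-- A criterion for the regular continued fraction expansion by complete quotients `y n`. -/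
lemma hasContFrac_of_complete {y : ℕ → ℝ} {a : ℕ → ℕ} (h1 : ∀ n, (a n : ℝ) < y n)
    (h2 : ∀ n, y n < a n + 1) (h : ∀ n, (y n - a n) * y (n + 1) = 1) : HasContFrac (y 0) a := by
  have hf : ∀ n, (Int.fract (y n))⁻¹ = y (n + 1) := fun n => by
    rw [fract_eq_sub (h1 n).le (h2 n)]
    exact inv_eq_of_mul_eq_one_right (h n)
  refine ⟨?_, fun n => ?_⟩
  · rw [GenContFract.of_h_eq_floor]
    have h3 : ⌊y 0⌋ = (a 0 : ℤ) := by
      rw [Int.floor_eq_iff]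
      exact ⟨by exact_mod_cast (h1 0).le, by exact_mod_cast h2 0⟩
    rw [h3, Int.cast_natCast]
  · have key : ∀ n m, (GenContFract.of (y m)).s.get? n = some ⟨1, (a (m + n + 1) : ℝ)⟩ := by
      intro n
      induction n with
      | zero =>
        intro m
        apply contFract_get?_zero
        · rw [hf]; exact h1 (m + 1)
        · rw [hf]; exact h2 (m + 1)
      | succ n ih =>
        intro m
        rw [GenContFract.of_s_succ, hf, ih, show m + 1 + n + 1 = m + (n + 1) + 1 by ring]
    simpa using key n 0

theorem hasContFrac_sqrt_three :
    HasContFrac (√3) (fun n => if n = 0 then 1 else if Even n then 2 else 1) := by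
  have hs : √3 * √3 = 3 := Real.mul_self_sqrt (by norm_num)
  have hlo : (1.73 : ℝ) ≤ √3 := Real.le_sqrt_of_sq_le (by norm_num)
  have hhi : √3 ≤ (1.7321 : ℝ) := Real.sqrt_le_iff.2 (by norm_num)
  apply hasContFrac_of_complete
    (y := fun n => if n = 0 then √3 else if Even n then √3 + 1 else (√3 + 1) / 2)
  · intro n
    rcases Nat.eq_zero_or_pos n with rfl | hn
    · norm_num; linarith
    · by_cases he : Even n <;> simp only [hn.ne', he, if_true, if_false] <;> push_cast <;> linarith
  · intro n
    rcases Nat.eq_zero_or_pos n with rfl | hn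
    · norm_num; linarith
    · by_cases he : Even n <;> simp only [hn.ne', he, if_true, if_false] <;> push_cast <;> linarith
  · intro n
    rcases Nat.eq_zero_or_pos n with rfl | hn
    · norm_num; linarith
    · by_cases he : Even n <;>
        simp only [hn.ne', he, if_true, if_false, Nat.even_add_one, not_true, not_false_iff,
          Nat.add_eq_zero_iff, false_and, one_ne_zero] <;> push_cast <;> linarith

theorem hasContFrac_sqrt_thirteen :
    HasContFrac ((7 + √13) / 6) (fun n => if n ≤ 1 then 1 else 3) := by
  have hs : √13 * √13 = 13 := Real.mul_self_sqrt (by norm_num)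
  have hlo : (3.6 : ℝ) ≤ √13 := Real.le_sqrt_of_sq_le (by norm_num)
  have hhi : √13 ≤ (3.61 : ℝ) := Real.sqrt_le_iff.2 (by norm_num)
  apply hasContFrac_of_complete (y := fun n =>
    if n = 0 then (7 + √13) / 6 else if n = 1 then (√13 - 1) / 2 else (√13 + 3) / 2)
  all_goals
    intro n
    obtain rfl | rfl | ⟨h0, h1, h2⟩ : n = 0 ∨ n = 1 ∨ n ≠ 0 ∧ n ≠ 1 ∧ ¬ n ≤ 1 := by omega
  all_goals
    try simp only [h0, h1, h2, Nat.add_eq_right, Nat.add_eq_zero_iff, one_ne_zero, and_false,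
      if_false]
    norm_num
    try linarith

end PalPrefix

theorem proposition7p7 :
    -- the two endpoints are `[1, 1, 2, 1, 2, 1, …]` and `[1, 1, 3, 3, 3, …]`
    PalPrefix.HasContFrac (Real.sqrt 3)
      (fun n => if n = 0 then 1 else if Even n then 2 else 1) ∧
    PalPrefix.HasContFrac ((7 + Real.sqrt 13) / 6)
      (fun n => if n ≤ 1 then 1 else 3) ∧
    -- no element of `𝒟'` lies strictly between them
    (∀ x ∈ PalPrefix.specD',
      ¬ (ENNReal.ofReal (Real.sqrt 3) < x ∧ x < ENNReal.ofReal ((7 + Real.sqrt 13) / 6))) ∧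
    -- `√3` cannot be replaced by a larger number in `𝒟' ∩ [1, √3] = 𝒟₀ ∩ [1, √3] = 𝒟 ∩ [1, √3]`
    (∀ c : ℝ, Real.sqrt 3 < c →
      PalPrefix.specD' ∩ Set.Icc 1 (ENNReal.ofReal c) ≠
          PalPrefix.specD0 ∩ Set.Icc 1 (ENNReal.ofReal c) ∧
      PalPrefix.specD' ∩ Set.Icc 1 (ENNReal.ofReal c) ≠
          PalPrefix.specD ∩ Set.Icc 1 (ENNReal.ofReal c)) := by
  refine ⟨PalPrefix.hasContFrac_sqrt_three, PalPrefix.hasContFrac_sqrt_thirteen,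
    fun x hx => PalPrefix.not_mem_specD'_of_mem_gap hx, fun c hc => ?_⟩
  have h3 : √3 ≤ (1.7321 : ℝ) := Real.sqrt_le_iff.2 (by norm_num)
  have h1 : (1 : ℝ) ≤ √3 := Real.le_sqrt_of_sq_le (by norm_num)
  have h13 : (3.6 : ℝ) ≤ √13 := Real.le_sqrt_of_sq_le (by norm_num)
  -- The bound 1.76 lies below (7+√13)/6, which exceeds 1.766, so `δ(w)` falls inside the gap.
  obtain ⟨w, hw, hlt, hle⟩ := PalPrefix.exists_abundant_delta_near_sqrt_three
    (lt_min hc (show √3 < 1.76 by linarith))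
  have hmem : PalPrefix.delta w ∈ Set.Icc 1 (ENNReal.ofReal c) :=
    ⟨le_trans (ENNReal.one_le_ofReal.2 h1) hlt.le,
      hle.trans (ENNReal.ofReal_le_ofReal (min_le_left _ _))⟩
  have hgap : PalPrefix.delta w < ENNReal.ofReal ((7 + √13) / 6) :=
    lt_of_le_of_lt (hle.trans (ENNReal.ofReal_le_ofReal (min_le_right _ _)))
      ((ENNReal.ofReal_lt_ofReal_iff (by positivity)).2 (by linarith))
  have hnot : PalPrefix.delta w ∉ PalPrefix.specD' := fun h =>
    PalPrefix.not_mem_specD'_of_mem_gap h ⟨hlt, hgap⟩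
  constructor
  · intro h
    exact hnot (h.symm.subset ⟨⟨Bool, w, hw, rfl⟩, hmem⟩).1
  · intro h
    exact hnot (h.symm.subset ⟨⟨Bool, w, rfl⟩, hmem⟩).1
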